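/- **Theorem.** For $n\ge 0$ let $S_n$ be the set of permutations $\pi=\pi_1\cdots\pi_n$ of $\{1,\dots,n\}$, and let $\operatorname{Av}_n(231,1243)$ be the set of those $\pi\in S_n$ that contain no subsequence in the same relative order as $231$ or as $1243$. A *hook* of $\pi$ with southwest endpoint $(i,\pi_i)$ and northeast endpoint $(j,\pi_j)$, where $i<j$ and $\pi_i<\pi_j$, is the union of the vertical segment from $(i,\pi_i)$ to $(i,\pi_j)$ and the horizontal segment from $(i,\pi_j)$ to $(j,\pi_j)$. Let $d_1<\dots<d_k$ be the descents of $\pi$, that is, the indices $d\in\{1,\dots,n-1\}$ with $\pi_d>\pi_{d+1}$. A *valid hook configuration* of $\pi$ is a tuple $(H_1,\dots,H_k)$ of hooks of $\pi$ such that 1. for every $i\in\{1,\dots,k\}$, the southwest endpoint of $H_i$ is $(d_i,\pi_{d_i})$; 2. no point $(l,\pi_l)$ lies directly above a hook; 3. two distinct hooks of the tuple do not meet, except that the northeast endpoint of one may be the southwest endpoint of the other. (A permutation without descents, including the empty one, has exactly one valid hook configuration, the empty tuple.) Let $\operatorname{VHC}(\operatorname{Av}_n(231,1243))$ be the set of all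 pairs of a permutation $\pi\in\operatorname{Av}_n(231,1243)$ and a valid hook configuration of $\pi$. Then $$\sum_{n\ge 0}\bigl|\operatorname{VHC}(\operatorname{Av}_n(231,1243))\bigr|\,x^n \;=\; 1+\frac{2x^2}{3x-1+\sqrt{1-2x-3x^2}},$$ where $\sqrt{1-2x-3x^2}$ is the formal power series over $\mathbb{Q}$ with constant term $1$ whose square is $1-2x-3x^2$, the series $3x-1+\sqrt{1-2x-3x^2}$ is nonzero, and the quotient is taken in the field of formal Laurent series. -/

import Mathlib

namespace HookConfig

/-- Permutations of `{1, …, n}` are modelled as permutations of `Fin n` (positions and values are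
shifted by one); `π i` is the entry in position `i`. The permutation `σ` contains the pattern `τ`
if some subsequence of `σ` is in the same relative order as `τ`. -/
def Contains {m n : ℕ} (σ : Equiv.Perm (Fin n)) (τ : Equiv.Perm (Fin m)) : Prop :=
  ∃ f : Fin m ↪o Fin n, ∀ a b : Fin m, σ (f a) < σ (f b) ↔ τ a < τ b

/-- The set of permutations of length `n` that avoid all the patterns in `P`. -/
def Av (n : ℕ) (P : Set (Σ m : ℕ, Equiv.Perm (Fin m))) : Set (Equiv.Perm (Fin n)) :=
  {σ | ∀ τ ∈ P, ¬ Contains σ τ.2}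

/-- The pattern `231`. -/
def p231 : Equiv.Perm (Fin 3) where
  toFun := ![1, 2, 0]
  invFun := ![2, 0, 1]
  left_inv := by decide
  right_inv := by decide

/-- The pattern `1243`. -/
def p1243 : Equiv.Perm (Fin 4) where
  toFun := ![0, 1, 3, 2]
  invFun := ![0, 1, 3, 2]
  left_inv := by decide
  right_inv := by decide

/-- `i` is a descent of `π` if position `i` has a successor and the entry there is smaller. -/
def IsDescent {n : ℕ} (π : Equiv.Perm (Fin n)) (i : Fin n) : Prop :=
  ∃ h : (i : ℕ) + 1 < n, π ⟨i + 1, h⟩ < π i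

/-- The point of the plot of `π` in column `i`. -/
def plotPoint {n : ℕ} (π : Equiv.Perm (Fin n)) (i : Fin n) : ℝ × ℝ :=
  (((i : ℕ) : ℝ), ((π i : ℕ) : ℝ))

/-- A hook of `π`, given by the columns of its southwest and northeast endpoints. -/
@[ext]
structure Hook {n : ℕ} (π : Equiv.Perm (Fin n)) where
  sw : Fin n
  ne : Fin n
  sw_lt_ne : sw < ne
  height_lt : π sw < π ne

/-- The hook as a subset of the plane: a vertical segment going up from the southwest endpoint,
followed by a horizontal segment going right to the northeast endpoint. -/
def Hook.points {n : ℕ} {π : Equiv.Perm (Fin n)} (H : Hook π) : Set (ℝ × ℝ) :=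
  {p | p.1 = (plotPoint π H.sw).1 ∧ (plotPoint π H.sw).2 ≤ p.2 ∧ p.2 ≤ (plotPoint π H.ne).2} ∪
  {p | p.2 = (plotPoint π H.ne).2 ∧ (plotPoint π H.sw).1 ≤ p.1 ∧ p.1 ≤ (plotPoint π H.ne).1}

/-- A valid hook configuration of `π`: the tuple of hooks is indexed by the descents of `π`. -/
@[ext]
structure VHC {n : ℕ} (π : Equiv.Perm (Fin n)) where
  hook : {d : Fin n // IsDescent π d} → Hook π
  /-- The southwest endpoint of each hook is the corresponding descent top. -/
  sw_hook : ∀ d, (hook d).sw = d.1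
  /-- No point of the plot lies directly above a hook. -/
  not_above : ∀ d, ∀ l : Fin n, ∀ q ∈ (hook d).points,
    ¬ (q.1 = (plotPoint π l).1 ∧ q.2 < (plotPoint π l).2)
  /-- Distinct hooks meet only where the northeast endpoint of one is the southwest endpoint of
  the other. -/
  inter : ∀ d e, d ≠ e → ∀ q ∈ (hook d).points ∩ (hook e).points,
    (q = plotPoint π (hook d).ne ∧ q = plotPoint π (hook e).sw) ∨
    (q = plotPoint π (hook d).sw ∧ q = plotPoint π (hook e).ne)

instance finite_hook {n : ℕ} (π : Equiv.Perm (Fin n)) : Finite (Hook π) :=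
  Finite.of_injective (fun H : Hook π => (H.sw, H.ne)) fun _ _ h =>
    Hook.ext (congrArg Prod.fst h) (congrArg Prod.snd h)

instance finite_vhc {n : ℕ} (π : Equiv.Perm (Fin n)) : Finite (VHC π) :=
  Finite.of_injective VHC.hook fun _ _ h => VHC.ext h

/-- The set of valid hook configurations (together with their underlying permutations) of the
permutations in `A`. It is finite, since the ambient type is. -/
def VHCs {n : ℕ} (A : Set (Equiv.Perm (Fin n))) : Set (Σ π : Equiv.Perm (Fin n), VHC π) :=
  {H | H.1 ∈ A}

end HookConfig

/-!
Allow descents without a hook, as long as they are not under another hook: such *open* descents can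
be hooked to entries appended later. Classify these partial configurations with `s` open descents
by the position of the maximum. If it is last, then it is either unhooked or it ends the hook of the
last open descent, since nestedness forces that choice. If it is first, then it is a new open
descent in front of an arbitrary configuration. If it is inside and the permutation avoids `231` and
`1243`, then the entries before it are consecutive and decreasing. Removing them one by one from the
left leads to a permutation that begins with its minimum followed by its maximum; without that
minimum it is an arbitrary avoider of `231` and `132` that begins with its maximum. Avoiders of
`231` and `132` themselves never have their maximum inside.

The generating functions of both classes thus satisfy the recurrence of Motzkin paths by final
height, with a source term. With `t = x (1 + t + t²)` the `231`, `132`-avoiders with `s` open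
descents are counted by `(1 + t + t²) tˢ`, and the generating function `c` of the nonempty
configurations of `231`, `1243`-avoiders without open descents, shifted by one, satisfies
`(1 - t) c = 1`. As `√(1 - 2x - 3x²) = 1 - x - 2xt`, the denominator of the claim is `2x (1 - t)`.
-/

namespace HookConfig

/-! ### Sequences -/

/-- A permutation of `{0, …, n - 1}`, encoded as a self-map of `ℕ` that fixes every `i ≥ n`, so that
permutations of different lengths live in one type. -/
structure IsPermSeq (n : ℕ) (σ : ℕ → ℕ) : Prop where
  injective : Function.Injective σ
  apply_of_le : ∀ i, n ≤ i → σ i = i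

/-- The self-map of `ℕ` that encodes the permutation `π`. -/
def extend {n : ℕ} (π : Equiv.Perm (Fin n)) : ℕ → ℕ :=
  π.viaFintypeEmbedding Fin.valEmbedding

lemma extend_val {n : ℕ} (π : Equiv.Perm (Fin n)) (i : Fin n) : extend π i = π i :=
  π.viaFintypeEmbedding_apply_image Fin.valEmbedding i

lemma isPermSeq_extend {n : ℕ} (π : Equiv.Perm (Fin n)) : IsPermSeq n (extend π) where
  injective := (π.viaFintypeEmbedding Fin.valEmbedding).injective
  apply_of_le i hi := π.viaFintypeEmbedding_apply_notMem_range _ <| by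
    rintro ⟨j, rfl⟩
    exact absurd j.isLt (not_lt.2 hi)

lemma extend_injective (n : ℕ) : Function.Injective (extend (n := n)) := fun π ρ h =>
  Equiv.ext fun i => Fin.ext <| by rw [← extend_val, ← extend_val, h]

namespace IsPermSeq

variable {n : ℕ} {σ : ℕ → ℕ}

lemma apply_lt_iff (hσ : IsPermSeq n σ) {i : ℕ} : σ i < n ↔ i < n := by
  constructor
  · intro h
    by_contra! hi
    exact absurd (hσ.apply_of_le i hi) (by omega)
  · intro h
    by_contra! hi
    exact absurd (hσ.injective (hσ.apply_of_le (σ i) hi)) (by omega)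

lemma succ (hσ : IsPermSeq n σ) : IsPermSeq (n + 1) σ :=
  ⟨hσ.injective, fun i hi => hσ.apply_of_le i (by omega)⟩

lemma exists_extend_eq (hσ : IsPermSeq n σ) : ∃ π : Equiv.Perm (Fin n), extend π = σ := by
  let g (i : Fin n) : Fin n := ⟨σ i, hσ.apply_lt_iff.2 i.isLt⟩
  have hg : Function.Injective g := fun i j h => Fin.ext (hσ.injective (Fin.ext_iff.1 h))
  refine ⟨Equiv.ofBijective g (Finite.injective_iff_bijective.1 hg), funext fun i => ?_⟩
  by_cases hi : i < n
  · exact extend_val _ ⟨i, hi⟩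
  · rw [hσ.apply_of_le i (not_lt.1 hi), (isPermSeq_extend _).apply_of_le i (not_lt.1 hi)]

lemma surjective (hσ : IsPermSeq n σ) : Function.Surjective σ := by
  obtain ⟨π, rfl⟩ := hσ.exists_extend_eq
  exact (π.viaFintypeEmbedding Fin.valEmbedding).surjective

lemma lt_of_inversion (hσ : IsPermSeq n σ) {i j : ℕ} (hij : i < j) (h : σ j < σ i) : j < n := by
  by_contra! hj
  have hi : σ i < n ↔ i < n := hσ.apply_lt_iff
  have := hσ.apply_of_le j hj
  have := hσ.apply_of_le i
  omega

lemma exists_apply_eq (hσ : IsPermSeq (n + 1) σ) : ∃ m ≤ n, σ m = n := by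
  obtain ⟨m, hm⟩ := hσ.surjective n
  exact ⟨m, Nat.lt_succ_iff.1 (hσ.apply_lt_iff.1 (by omega)), hm⟩

lemma iff_succ_and_apply_eq : IsPermSeq n σ ↔ IsPermSeq (n + 1) σ ∧ σ n = n := by
  refine ⟨fun hσ => ⟨hσ.succ, hσ.apply_of_le n le_rfl⟩, ?_⟩
  refine fun ⟨hσ, hn⟩ => ⟨hσ.injective, fun i hi => ?_⟩
  rcases hi.eq_or_lt with rfl | hi
  exacts [hn, hσ.apply_of_le i hi]

end IsPermSeq

lemma finite_setOf_isPermSeq (n : ℕ) : {σ | IsPermSeq n σ}.Finite :=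
  (Set.finite_range (extend (n := n))).subset fun _ hσ => hσ.exists_extend_eq

/-- The sequence `σ` with a new first entry `v`; the entries of `σ` that are at least `v` are raised
by one to make room. -/
def prependEntry (v : ℕ) (σ : ℕ → ℕ) : ℕ → ℕ
  | 0 => v
  | i + 1 => if σ i < v then σ i else σ i + 1

section prependEntry

variable {v n : ℕ} {σ : ℕ → ℕ}

@[simp] lemma prependEntry_zero : prependEntry v σ 0 = v := rfl

lemma prependEntry_succ (i : ℕ) :
    prependEntry v σ (i + 1) = if σ i < v then σ i else σ i + 1 := rfl

@[simp] lemma prependEntry_succ_lt_succ {i j : ℕ} :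
    prependEntry v σ (i + 1) < prependEntry v σ (j + 1) ↔ σ i < σ j := by
  simp only [prependEntry_succ]
  split_ifs <;> omega

@[simp] lemma prependEntry_succ_lt {i : ℕ} : prependEntry v σ (i + 1) < v ↔ σ i < v := by
  rw [prependEntry_succ]
  split_ifs <;> omega

@[simp] lemma lt_prependEntry_succ {i : ℕ} : v < prependEntry v σ (i + 1) ↔ v ≤ σ i := by
  rw [prependEntry_succ]
  split_ifs <;> omega

lemma prependEntry_succ_eq_succ_iff (hv : v ≤ n) {i : ℕ} :
    prependEntry v σ (i + 1) = n + 1 ↔ σ i = n := by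
  rw [prependEntry_succ]
  split_ifs <;> omega

lemma prependEntry_right_injective (v : ℕ) : Function.Injective (prependEntry v) := by
  intro σ τ h
  funext i
  have hi := congrFun h (i + 1)
  simp only [prependEntry_succ] at hi
  split_ifs at hi <;> omega

lemma injective_prependEntry_iff :
    Function.Injective (prependEntry v σ) ↔ Function.Injective σ := by
  have succ_eq (i j : ℕ) :
      prependEntry v σ (i + 1) = prependEntry v σ (j + 1) ↔ σ i = σ j := by
    simp only [prependEntry_succ]
    split_ifs <;> omega
  have succ_ne (i : ℕ) : prependEntry v σ (i + 1) ≠ v := by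
    rw [prependEntry_succ]
    split_ifs <;> omega
  refine ⟨fun h i j hij => Nat.succ_injective (h ((succ_eq i j).2 hij)), fun h i j hij => ?_⟩
  rcases i with _ | i <;> rcases j with _ | j
  · rfl
  · exact absurd hij.symm (succ_ne j)
  · exact absurd hij (succ_ne i)
  · rw [h ((succ_eq i j).1 hij)]

lemma exists_prependEntry_eq (hσ : Function.Injective σ) : ∃ τ, prependEntry (σ 0) τ = σ := by
  refine ⟨fun i => if σ (i + 1) < σ 0 then σ (i + 1) else σ (i + 1) - 1, funext fun i => ?_⟩
  rcases i with _ | i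
  · rfl
  · have hne : σ (i + 1) ≠ σ 0 := hσ.ne (Nat.succ_ne_zero i)
    rw [prependEntry_succ]
    split_ifs <;> omega

lemma isPermSeq_succ_prependEntry_iff :
    IsPermSeq (n + 1) (prependEntry v σ) ↔ IsPermSeq n σ ∧ v ≤ n := by
  constructor
  · intro h
    have hv : v ≤ n := Nat.lt_succ_iff.1 (h.apply_lt_iff.2 n.succ_pos)
    refine ⟨⟨injective_prependEntry_iff.1 h.injective, fun i hi => ?_⟩, hv⟩
    have hi' := h.apply_of_le (i + 1) (by omega)
    rw [prependEntry_succ] at hi'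
    split_ifs at hi' <;> omega
  · rintro ⟨h, hv⟩
    refine ⟨injective_prependEntry_iff.2 h.injective, fun i hi => ?_⟩
    obtain ⟨i, rfl⟩ : ∃ j, i = j + 1 := ⟨i - 1, by omega⟩
    have hi' := h.apply_of_le i (by omega)
    rw [prependEntry_succ]
    split_ifs <;> omega

end prependEntry

/-! ### Pattern avoidance -/

/-- Avoidance of the pattern `231` by an infinite sequence. -/
def Avoids231 (σ : ℕ → ℕ) : Prop := ∀ ⦃i j k⦄, i < j → j < k → σ k < σ i → ¬ σ i < σ j

/-- Avoidance of the pattern `132` by an infinite sequence. -/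
def Avoids132 (σ : ℕ → ℕ) : Prop := ∀ ⦃i j k⦄, i < j → j < k → σ i < σ k → ¬ σ k < σ j

/-- Avoidance of the pattern `1243` by an infinite sequence. -/
def Avoids1243 (σ : ℕ → ℕ) : Prop :=
  ∀ ⦃i j k l⦄, i < j → j < k → k < l → σ i < σ j → σ j < σ l → ¬ σ l < σ k

/-- The sequences that avoid `231` and `1243`. -/
def avoiders231And1243 : Set (ℕ → ℕ) := {σ | Avoids231 σ ∧ Avoids1243 σ}

/-- The sequences that avoid `231` and `132`. -/
def avoiders231And132 : Set (ℕ → ℕ) := {σ | Avoids231 σ ∧ Avoids132 σ}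

lemma id_mem_avoiders231And1243 : id ∈ avoiders231And1243 :=
  ⟨fun _ _ _ hij hjk hki => absurd hki (hij.trans hjk).not_gt,
    fun _ _ _ _ _ _ hkl _ _ hlk => lt_asymm hkl hlk⟩

lemma id_mem_avoiders231And132 : id ∈ avoiders231And132 :=
  ⟨id_mem_avoiders231And1243.1, fun _ _ _ _ hjk _ hkj => lt_asymm hjk hkj⟩

section avoidance

variable {v n : ℕ} {σ : ℕ → ℕ}

lemma avoids231_prependEntry_iff :
    Avoids231 (prependEntry v σ) ↔ Avoids231 σ ∧ ∀ j k, j < k → σ k < v → σ j < v := by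
  constructor
  · intro h
    exact ⟨fun i j k hij hjk => by simpa using @h (i + 1) (j + 1) (k + 1) (by omega) (by omega),
      fun j k hjk => by simpa using @h 0 (j + 1) (k + 1) (by omega) (by omega)⟩
  · rintro ⟨h, hv⟩ (_ | i) (_ | j) (_ | k) hij hjk
    all_goals try omega
    · simpa using hv j k (by omega)
    · simpa using @h i j k (by omega) (by omega)

lemma avoids132_prependEntry_iff :
    Avoids132 (prependEntry v σ) ↔ Avoids132 σ ∧ ∀ j k, j < k → v ≤ σ k → σ j ≤ σ k := by
  constructor
  · intro h
    exact ⟨fun i j k hij hjk => by simpa using @h (i + 1) (j + 1) (k + 1) (by omega) (by omega),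
      fun j k hjk => by simpa using @h 0 (j + 1) (k + 1) (by omega) (by omega)⟩
  · rintro ⟨h, hv⟩ (_ | i) (_ | j) (_ | k) hij hjk
    all_goals try omega
    · simpa using hv j k (by omega)
    · simpa using @h i j k (by omega) (by omega)

lemma avoids1243_prependEntry_iff :
    Avoids1243 (prependEntry v σ) ↔
      Avoids1243 σ ∧ ∀ j k l, j < k → k < l → v ≤ σ j → σ j < σ l → σ k ≤ σ l := by
  constructor
  · intro h
    exact ⟨fun i j k l hij hjk hkl => by
        simpa using @h (i + 1) (j + 1) (k + 1) (l + 1) (by omega) (by omega) (by omega),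
      fun j k l hjk hkl => by
        simpa using @h 0 (j + 1) (k + 1) (l + 1) (by omega) (by omega) (by omega)⟩
  · rintro ⟨h, hv⟩ (_ | i) (_ | j) (_ | k) (_ | l) hij hjk hkl
    all_goals try omega
    · simpa using hv j k l (by omega) (by omega)
    · simpa using @h i j k l (by omega) (by omega) (by omega)

lemma IsPermSeq.prependEntry_mem_avoiders231And1243_iff (hσ : IsPermSeq n σ) :
    prependEntry n σ ∈ avoiders231And1243 ↔ σ ∈ avoiders231And1243 := by
  have h231 (j k : ℕ) (hjk : j < k) (hk : σ k < n) : σ j < n :=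
    hσ.apply_lt_iff.2 (hjk.trans (hσ.apply_lt_iff.1 hk))
  have h1243 (j k l : ℕ) (hjk : j < k) (hkl : k < l) (hj : n ≤ σ j) (_ : σ j < σ l) :
      σ k ≤ σ l := by
    have hnj : n ≤ j := not_lt.1 fun h => not_lt.2 hj (hσ.apply_lt_iff.2 h)
    rw [hσ.apply_of_le k (by omega), hσ.apply_of_le l (by omega)]
    exact hkl.le
  exact and_congr (avoids231_prependEntry_iff.trans (and_iff_left h231))
    (avoids1243_prependEntry_iff.trans (and_iff_left h1243))

lemma IsPermSeq.prependEntry_mem_avoiders231And132_iff (hσ : IsPermSeq n σ) :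
    prependEntry n σ ∈ avoiders231And132 ↔ σ ∈ avoiders231And132 := by
  have h231 (j k : ℕ) (hjk : j < k) (hk : σ k < n) : σ j < n :=
    hσ.apply_lt_iff.2 (hjk.trans (hσ.apply_lt_iff.1 hk))
  have h132 (j k : ℕ) (hjk : j < k) (hk : n ≤ σ k) : σ j ≤ σ k := by
    have hnk : n ≤ k := not_lt.1 fun h => not_lt.2 hk (hσ.apply_lt_iff.2 h)
    by_contra! hkj
    rw [hσ.apply_of_le k hnk] at hkj
    exact absurd (hσ.injective (hσ.apply_of_le (σ j) (by omega))) (by omega)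
  exact and_congr (avoids231_prependEntry_iff.trans (and_iff_left h231))
    (avoids132_prependEntry_iff.trans (and_iff_left h132))

lemma prependEntry_zero_mem_avoiders231And1243_iff :
    prependEntry 0 σ ∈ avoiders231And1243 ↔ σ ∈ avoiders231And132 := by
  refine and_congr (avoids231_prependEntry_iff.trans (and_iff_left (by simp))) ?_
  rw [avoids1243_prependEntry_iff]
  constructor
  · rintro ⟨-, h⟩ i j k hij hjk hik
    exact not_lt.2 (h i j k hij hjk (Nat.zero_le _) hik)
  · intro h
    exact ⟨fun i j k l _ hjk hkl _ hjl => h hjk hkl hjl,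
      fun j k l hjk hkl _ hjl => not_lt.1 (h hjk hkl hjl)⟩

lemma prependEntry_succ_mem_avoiders231And1243_iff (hσ : Function.Injective σ) :
    prependEntry (σ 0 + 1) σ ∈ avoiders231And1243 ↔ σ ∈ avoiders231And1243 := by
  have h231 (h : Avoids231 σ) (j k : ℕ) (hjk : j < k) (hk : σ k < σ 0 + 1) : σ j < σ 0 + 1 := by
    have hk' : σ k < σ 0 := (Nat.lt_succ_iff.1 hk).lt_of_ne (hσ.ne (by omega))
    rcases j.eq_zero_or_pos with rfl | hj
    · exact Nat.lt_succ_self _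
    · have := h hj hjk hk'
      omega
  have h1243 (h : Avoids1243 σ) (j k l : ℕ) (hjk : j < k) (hkl : k < l) (hj : σ 0 + 1 ≤ σ j)
      (hjl : σ j < σ l) : σ k ≤ σ l := by
    have hj0 : 0 < j := Nat.pos_of_ne_zero (by rintro rfl; omega)
    exact not_lt.1 (h hj0 hjk hkl hj hjl)
  exact and_congr (avoids231_prependEntry_iff.trans (and_iff_left_of_imp h231))
    (avoids1243_prependEntry_iff.trans (and_iff_left_of_imp h1243))

end avoidance

section max

variable {n m : ℕ} {σ : ℕ → ℕ}

lemma IsPermSeq.apply_lt_of_ne_max (hσ : IsPermSeq (n + 1) σ) (hm : σ m = n) {i : ℕ} (hi : i ≤ n)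
    (him : i ≠ m) : σ i < n :=
  (Nat.lt_succ_iff.1 (hσ.apply_lt_iff.2 (Nat.lt_succ_iff.2 hi))).lt_of_ne
    (hm ▸ hσ.injective.ne him)

lemma IsPermSeq.max_column_le (hσ : IsPermSeq (n + 1) σ) (hm : σ m = n) : m ≤ n :=
  Nat.lt_succ_iff.1 (hσ.apply_lt_iff.1 (by omega))

lemma Avoids231.lt_of_lt_max (h231 : Avoids231 σ) (hσ : IsPermSeq (n + 1) σ) (hm : σ m = n)
    {i j : ℕ} (hi : i < m) (hj : m < j) : σ i < σ j := by
  have hmn := hσ.max_column_le hm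
  have him : σ i < σ m := hm ▸ hσ.apply_lt_of_ne_max hm (by omega) hi.ne
  by_contra! hji
  exact h231 hi hj (hji.lt_of_ne (hσ.injective.ne (by omega))) him

lemma apply_lt_apply_of_lt_max (hA : σ ∈ avoiders231And1243) (hσ : IsPermSeq (n + 1) σ)
    (hm : σ m = n) (hmn : m < n) {i j : ℕ} (hij : i < j) (hjm : j < m) : σ j < σ i := by
  have hj : σ j < σ (m + 1) := hA.1.lt_of_lt_max hσ hm hjm (Nat.lt_succ_self m)
  have hmax : σ (m + 1) < σ m := hm ▸ hσ.apply_lt_of_ne_max hm hmn (Nat.succ_ne_self m)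
  by_contra! hle
  exact hA.2 hij hjm (Nat.lt_succ_self m) (hle.lt_of_ne (hσ.injective.ne hij.ne)) hj hmax

lemma Avoids231.apply_zero_eq_zero (h231 : Avoids231 σ) (hσ : IsPermSeq (n + 1) σ) (h1 : σ 1 = n)
    (hn : 0 < n) : σ 0 = 0 := by
  obtain ⟨k, hk⟩ := hσ.surjective 0
  rcases lt_trichotomy k 1 with hk1 | rfl | hk1
  · rwa [Nat.lt_one_iff.1 hk1] at hk
  · omega
  · have := h231.lt_of_lt_max hσ h1 one_pos hk1
    omega

lemma apply_zero_eq_apply_one_add_one (hA : σ ∈ avoiders231And1243) (hσ : IsPermSeq (n + 1) σ)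
    (hm : σ m = n) (hmn : m < n) (h1 : 1 < m) : σ 0 = σ 1 + 1 := by
  have h10 := apply_lt_apply_of_lt_max hA hσ hm hmn one_pos h1
  have h0 := hσ.apply_lt_of_ne_max hm n.zero_le (by omega)
  by_contra! hne
  obtain ⟨k, hk⟩ := hσ.surjective (σ 1 + 1)
  have hk0 : k ≠ 0 := by rintro rfl; omega
  have hk1 : k ≠ 1 := by rintro rfl; omega
  rcases lt_trichotomy k m with hkm | rfl | hkm
  · have := apply_lt_apply_of_lt_max hA hσ hm hmn (show 1 < k by omega) hkm
    omega
  · omega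
  · have := hA.1.lt_of_lt_max hσ hm (zero_lt_one.trans h1) hkm
    omega

end max

/-! ### Partial configurations -/

/-- A sequence together with hooks at some of its columns: `hookEnd d` is the column of the
northeast endpoint of the hook at column `d`, and `hookEnd d = 0` means that there is no such hook,
which is unambiguous because no hook ends in column `0`. -/
@[ext]
structure HookedSeq where
  entry : ℕ → ℕ
  hookEnd : ℕ → ℕ

/-- The descents that carry no hook. -/
def HookedSeq.openDescents (p : HookedSeq) : Set ℕ :=
  {d | p.entry (d + 1) < p.entry d ∧ p.hookEnd d = 0}

/-- Some hook ends at the entry of value `v`. -/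
def HookedSeq.HooksTo (p : HookedSeq) (v : ℕ) : Prop :=
  ∃ d, p.hookEnd d ≠ 0 ∧ p.entry (p.hookEnd d) = v

/-- Some open descent lies to the left of the entry of value `v`. -/
def HookedSeq.HasOpenBefore (p : HookedSeq) (v : ℕ) : Prop :=
  ∃ d ∈ p.openDescents, ∃ m, d < m ∧ p.entry m = v

/-- A valid hook configuration of a permutation of length `n` in which hooks are required only for
the descents under another hook: the descents without a hook are the ones that can still be hooked
to entries added on the right. -/
structure IsPartialConfig (n : ℕ) (p : HookedSeq) : Prop where
  isPermSeq : IsPermSeq n p.entry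
  descent : ∀ d, p.hookEnd d ≠ 0 → p.entry (d + 1) < p.entry d
  lt_hookEnd : ∀ d, p.hookEnd d ≠ 0 → d < p.hookEnd d
  hookEnd_lt : ∀ d, p.hookEnd d ≠ 0 → p.hookEnd d < n
  entry_lt : ∀ d l, d ≤ l → l < p.hookEnd d → p.entry l < p.entry (p.hookEnd d)
  nested : ∀ d e, d < e → e < p.hookEnd d → p.entry (e + 1) < p.entry e →
    p.hookEnd e ≠ 0 ∧ p.hookEnd e < p.hookEnd d

/-- The partial configurations of length `n` with underlying sequence in `A` and `s` open
descents. -/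
def configs (A : Set (ℕ → ℕ)) (n s : ℕ) : Set HookedSeq :=
  {p | IsPartialConfig n p ∧ p.entry ∈ A ∧ p.openDescents.ncard = s}

/-- The sequences with value `n` in column `m`. -/
def maxAt (n m : ℕ) : Set (ℕ → ℕ) := {σ | σ m = n}

/-- The partial configurations of length `n + 1` without a hook that ends at the maximal
entry `n`. -/
def freeConfigs (A : Set (ℕ → ℕ)) (n s : ℕ) : Set HookedSeq :=
  {p ∈ configs A (n + 1) s | ¬ p.HooksTo n}

section finiteness

lemma finite_setOf_isPartialConfig (n : ℕ) : {p | IsPartialConfig n p}.Finite := by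
  have hends : {f : ℕ → ℕ | ∀ d, f d ≠ 0 → d < n ∧ f d < n}.Finite := by
    refine Set.Finite.of_injOn (f := fun f (d : Fin n) => f d)
      (t := Set.univ.pi fun _ => Set.Iic n) (fun f hf d _ => ?_) (fun f hf g hg h => ?_)
      (Set.Finite.pi fun _ => Set.finite_Iic n)
    · by_cases hd : f d = 0
      · exact hd.trans_le n.zero_le
      · exact (hf d hd).2.le
    · funext d
      by_cases hd : d < n
      · exact congrFun h ⟨d, hd⟩
      · rw [not_not.1 (mt (hf d) fun h => hd h.1), not_not.1 (mt (hg d) fun h => hd h.1)]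
  refine ((finite_setOf_isPermSeq n).image2 HookedSeq.mk hends).subset fun p hp => ?_
  exact ⟨p.entry, hp.isPermSeq, p.hookEnd,
    fun d hd => ⟨(hp.lt_hookEnd d hd).trans (hp.hookEnd_lt d hd), hp.hookEnd_lt d hd⟩, rfl⟩

lemma finite_configs (A : Set (ℕ → ℕ)) (n s : ℕ) : (configs A n s).Finite :=
  (finite_setOf_isPartialConfig n).subset fun _ hp => hp.1

variable {n : ℕ} {p : HookedSeq}

lemma IsPartialConfig.openDescents_subset_Iio (hp : IsPartialConfig n p) :
    p.openDescents ⊆ Set.Iio n := fun d hd =>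
  d.lt_succ_self.trans (hp.isPermSeq.lt_of_inversion d.lt_succ_self hd.1)

lemma IsPartialConfig.finite_openDescents (hp : IsPartialConfig n p) : p.openDescents.Finite :=
  (Set.finite_Iio n).subset hp.openDescents_subset_Iio

lemma ncard_configs_inter_add_sdiff (A P : Set (ℕ → ℕ)) (n s : ℕ) :
    (configs (A ∩ P) n s).ncard + (configs (A \ P) n s).ncard = (configs A n s).ncard := by
  rw [← Set.ncard_inter_add_ncard_sdiff_eq_ncard (configs A n s) {p | p.entry ∈ P}
    (finite_configs A n s)]
  congr 2 <;> ext p <;> simp only [configs, Set.mem_inter_iff, Set.mem_sdiff, Set.mem_ofPred_eq] <;>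
    tauto

end finiteness

lemma isPartialConfig_iff_eq_of_le_one {n : ℕ} (hn : n ≤ 1) {p : HookedSeq} :
    IsPartialConfig n p ↔ p = ⟨id, 0⟩ := by
  constructor
  · intro hp
    refine HookedSeq.ext (funext fun i => ?_) (funext fun d => ?_)
    · rcases le_or_gt n i with hi | hi
      · exact hp.isPermSeq.apply_of_le i hi
      · have := hp.isPermSeq.apply_lt_iff.2 hi
        simp only [id_eq]
        omega
    · change p.hookEnd d = 0
      by_contra hd
      have := hp.lt_hookEnd d hd
      have := hp.hookEnd_lt d hd
      omega
  · rintro rfl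
    exact ⟨⟨Function.injective_id, fun _ _ => rfl⟩, by simp, by simp, by simp, by simp, by simp⟩

lemma ncard_configs_of_le_one {A : Set (ℕ → ℕ)} (hA : id ∈ A) {n : ℕ} (hn : n ≤ 1) (s : ℕ) :
    (configs A n s).ncard = if s = 0 then 1 else 0 := by
  have hopen : (⟨id, 0⟩ : HookedSeq).openDescents = ∅ := by
    simp [HookedSeq.openDescents]
  split_ifs with hs
  · subst hs
    refine Set.ncard_eq_one.2 ⟨⟨id, 0⟩, Set.ext fun p => ?_⟩
    refine ⟨fun hp => (isPartialConfig_iff_eq_of_le_one hn).1 hp.1, ?_⟩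
    rintro rfl
    exact ⟨(isPartialConfig_iff_eq_of_le_one hn).2 rfl, hA, by rw [hopen, Set.ncard_empty]⟩
  · convert Set.ncard_empty HookedSeq
    refine Set.eq_empty_of_forall_notMem fun p ⟨hp, _, hps⟩ => hs ?_
    rw [← hps, (isPartialConfig_iff_eq_of_le_one hn).1 hp, hopen, Set.ncard_empty]

/-! ### A new first entry -/

namespace HookedSeq

/-- The configuration `p` with a new first entry `v` that carries no hook. -/
def prepend (v : ℕ) (p : HookedSeq) : HookedSeq where
  entry := prependEntry v p.entry
  hookEnd d := d.casesOn 0 fun d => if p.hookEnd d = 0 then 0 else p.hookEnd d + 1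

variable {v n : ℕ} {p : HookedSeq}

@[simp] lemma prepend_entry : (prepend v p).entry = prependEntry v p.entry := rfl

@[simp] lemma prepend_hookEnd_zero : (prepend v p).hookEnd 0 = 0 := rfl

lemma prepend_hookEnd_succ (d : ℕ) :
    (prepend v p).hookEnd (d + 1) = if p.hookEnd d = 0 then 0 else p.hookEnd d + 1 := rfl

@[simp] lemma prepend_hookEnd_succ_eq_zero {d : ℕ} :
    (prepend v p).hookEnd (d + 1) = 0 ↔ p.hookEnd d = 0 := by
  rw [prepend_hookEnd_succ]
  split_ifs with h <;> simp [h]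

lemma prepend_hookEnd_succ_of_ne_zero {d : ℕ} (hd : p.hookEnd d ≠ 0) :
    (prepend v p).hookEnd (d + 1) = p.hookEnd d + 1 := if_neg hd

@[simp] lemma succ_lt_prepend_hookEnd_succ {d e : ℕ} :
    e + 1 < (prepend v p).hookEnd (d + 1) ↔ e < p.hookEnd d := by
  rw [prepend_hookEnd_succ]
  split_ifs <;> omega

lemma prepend_injective (v : ℕ) : Function.Injective (prepend v) := fun p q h => by
  refine HookedSeq.ext (prependEntry_right_injective v (congrArg entry h)) (funext fun d => ?_)
  have hd := congrFun (congrArg hookEnd h) (d + 1)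
  simp only [prepend_hookEnd_succ] at hd
  split_ifs at hd <;> omega

lemma openDescents_prepend_of_lt (h : p.entry 0 < v) :
    (prepend v p).openDescents = insert 0 (Nat.succ '' p.openDescents) := by
  ext (_ | d)
  · simpa [openDescents] using h
  · simp [openDescents]

lemma openDescents_prepend_of_le (h : v ≤ p.entry 0) :
    (prepend v p).openDescents = Nat.succ '' p.openDescents := by
  ext (_ | d)
  · simpa [openDescents] using h
  · simp [openDescents]

lemma ncard_openDescents_prepend_of_lt (hp : p.openDescents.Finite) (h : p.entry 0 < v) :
    (prepend v p).openDescents.ncard = p.openDescents.ncard + 1 := by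
  rw [openDescents_prepend_of_lt h, Set.ncard_insert_of_notMem (by simp) (hp.image _),
    Set.ncard_image_of_injective _ Nat.succ_injective]

lemma ncard_openDescents_prepend_of_le (h : v ≤ p.entry 0) :
    (prepend v p).openDescents.ncard = p.openDescents.ncard := by
  rw [openDescents_prepend_of_le h, Set.ncard_image_of_injective _ Nat.succ_injective]

lemma hooksTo_prepend_iff (hv : v ≤ n) : (prepend v p).HooksTo (n + 1) ↔ p.HooksTo n := by
  constructor
  · rintro ⟨_ | d, hd, hn⟩
    · exact absurd prepend_hookEnd_zero hd
    · have hd' := mt prepend_hookEnd_succ_eq_zero.2 hd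
      rw [prepend_hookEnd_succ_of_ne_zero hd'] at hn
      exact ⟨d, hd', (prependEntry_succ_eq_succ_iff hv).1 hn⟩
  · rintro ⟨d, hd, hn⟩
    refine ⟨d + 1, mt prepend_hookEnd_succ_eq_zero.1 hd, ?_⟩
    rw [prepend_hookEnd_succ_of_ne_zero hd]
    exact (prependEntry_succ_eq_succ_iff hv).2 hn

end HookedSeq

section prepend

open HookedSeq

variable {v n : ℕ} {p : HookedSeq}

lemma IsPartialConfig.of_prepend (h : IsPartialConfig (n + 1) (prepend v p)) :
    IsPartialConfig n p := by
  have hne {d : ℕ} (hd : p.hookEnd d ≠ 0) : (prepend v p).hookEnd (d + 1) ≠ 0 :=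
    mt prepend_hookEnd_succ_eq_zero.1 hd
  refine ⟨(isPermSeq_succ_prependEntry_iff.1 h.isPermSeq).1, fun d hd => ?_, fun d hd => ?_,
    fun d hd => ?_, fun d l hdl hl => ?_, fun d e hde he hdes => ?_⟩
  · simpa using h.descent (d + 1) (hne hd)
  · simpa using h.lt_hookEnd (d + 1) (hne hd)
  · simpa [prepend_hookEnd_succ_of_ne_zero hd] using h.hookEnd_lt (d + 1) (hne hd)
  · have hd : p.hookEnd d ≠ 0 := by omega
    simpa [prepend_hookEnd_succ_of_ne_zero hd] using
      h.entry_lt (d + 1) (l + 1) (by omega) (succ_lt_prepend_hookEnd_succ.2 hl)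
  · have hd : p.hookEnd d ≠ 0 := by omega
    have h' := h.nested (d + 1) (e + 1) (by omega) (succ_lt_prepend_hookEnd_succ.2 he)
      (prependEntry_succ_lt_succ.2 hdes)
    have he := mt prepend_hookEnd_succ_eq_zero.2 h'.1
    rw [prepend_hookEnd_succ_of_ne_zero hd, prepend_hookEnd_succ_of_ne_zero he] at h'
    exact ⟨he, by omega⟩

lemma IsPartialConfig.prepend (h : IsPartialConfig n p) (hv : v ≤ n) :
    IsPartialConfig (n + 1) (prepend v p) := by
  have hne {d : ℕ} (hd : (HookedSeq.prepend v p).hookEnd (d + 1) ≠ 0) : p.hookEnd d ≠ 0 :=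
    mt prepend_hookEnd_succ_eq_zero.2 hd
  refine ⟨isPermSeq_succ_prependEntry_iff.2 ⟨h.isPermSeq, hv⟩, ?_, ?_, ?_, ?_, ?_⟩
  · rintro (_ | d) hd
    · exact absurd prepend_hookEnd_zero hd
    · simpa using h.descent d (hne hd)
  · rintro (_ | d) hd
    · exact absurd prepend_hookEnd_zero hd
    · simpa using h.lt_hookEnd d (hne hd)
  · rintro (_ | d) hd
    · exact absurd prepend_hookEnd_zero hd
    · simpa [prepend_hookEnd_succ_of_ne_zero (hne hd)] using h.hookEnd_lt d (hne hd)
  · rintro (_ | d) (_ | l) hdl hl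
    · exact absurd hl (lt_irrefl 0)
    · exact absurd hl (Nat.not_lt_zero _)
    · omega
    · have hl := succ_lt_prepend_hookEnd_succ.1 hl
      simpa [prepend_hookEnd_succ_of_ne_zero (Nat.ne_zero_of_lt hl)] using
        h.entry_lt d l (by omega) hl
  · rintro (_ | d) (_ | e) hde he hdes
    · exact absurd he (lt_irrefl 0)
    · exact absurd he (Nat.not_lt_zero _)
    · omega
    · have he := succ_lt_prepend_hookEnd_succ.1 he
      have h' := h.nested d e (by omega) he (prependEntry_succ_lt_succ.1 hdes)
      simpa [prepend_hookEnd_succ_of_ne_zero (Nat.ne_zero_of_lt he),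
        prepend_hookEnd_succ_of_ne_zero h'.1] using h'.2

lemma IsPartialConfig.exists_prepend_eq (hp : IsPartialConfig n p) (h0 : p.hookEnd 0 = 0) :
    ∃ v q, HookedSeq.prepend v q = p := by
  obtain ⟨τ, hτ⟩ := exists_prependEntry_eq hp.isPermSeq.injective
  refine ⟨p.entry 0, ⟨τ, fun d => p.hookEnd (d + 1) - 1⟩, HookedSeq.ext hτ (funext fun d => ?_)⟩
  rcases d with _ | d
  · exact h0.symm
  · have := hp.lt_hookEnd (d + 1)
    simp only [prepend_hookEnd_succ]
    split_ifs <;> omega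

end prepend

/-! ### The hook at the maximum -/

section maxHook

namespace HookedSeq

/-- The configuration `p` without the hook that ends at the entry of value `v`. -/
def unhook (v : ℕ) (p : HookedSeq) : HookedSeq where
  entry := p.entry
  hookEnd d := if p.entry (p.hookEnd d) = v then 0 else p.hookEnd d

/-- The configuration `p` with a hook from column `d` to column `m`. -/
def addHook (d m : ℕ) (p : HookedSeq) : HookedSeq where
  entry := p.entry
  hookEnd := Function.update p.hookEnd d m

variable {v d m : ℕ} {p : HookedSeq}

@[simp] lemma unhook_entry : (unhook v p).entry = p.entry := rfl

@[simp] lemma addHook_entry : (addHook d m p).entry = p.entry := rfl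

@[simp] lemma addHook_hookEnd_self : (addHook d m p).hookEnd d = m :=
  Function.update_self ..

@[simp] lemma addHook_hookEnd_of_ne {e : ℕ} (h : e ≠ d) :
    (addHook d m p).hookEnd e = p.hookEnd e := Function.update_of_ne h ..

lemma unhook_hookEnd_of_eq {e : ℕ} (h : p.entry (p.hookEnd e) = v) :
    (unhook v p).hookEnd e = 0 := if_pos h

lemma unhook_hookEnd_of_ne {e : ℕ} (h : p.entry (p.hookEnd e) ≠ v) :
    (unhook v p).hookEnd e = p.hookEnd e := if_neg h

lemma unhook_hookEnd_eq_zero_iff {e : ℕ} :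
    (unhook v p).hookEnd e = 0 ↔ p.hookEnd e = 0 ∨ p.entry (p.hookEnd e) = v := by
  by_cases h : p.entry (p.hookEnd e) = v
  · simp [unhook_hookEnd_of_eq h, h]
  · simp [unhook_hookEnd_of_ne h, h]

lemma entry_hookEnd_ne_of_unhook_hookEnd_ne_zero {e : ℕ} (h : (unhook v p).hookEnd e ≠ 0) :
    p.entry (p.hookEnd e) ≠ v := fun h' => h (unhook_hookEnd_of_eq h')

lemma not_hooksTo_unhook : ¬ (unhook v p).HooksTo v := by
  rintro ⟨d, hd, hv⟩
  have hne := entry_hookEnd_ne_of_unhook_hookEnd_ne_zero hd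
  rw [unhook_hookEnd_of_ne hne] at hv
  exact hne hv

lemma unhook_addHook (hm : p.entry m = v) (hd : p.hookEnd d = 0) (hv : ¬ p.HooksTo v) :
    unhook v (addHook d m p) = p := by
  refine HookedSeq.ext rfl (funext fun e => ?_)
  rcases eq_or_ne e d with rfl | hed
  · rw [hd, unhook_hookEnd_of_eq (by simpa using hm)]
  · by_cases he : p.entry (p.hookEnd e) = v
    · rw [unhook_hookEnd_of_eq (by simpa [hed] using he)]
      by_contra h0
      exact hv ⟨e, Ne.symm h0, he⟩
    · rw [unhook_hookEnd_of_ne (by simpa [hed] using he), addHook_hookEnd_of_ne hed]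

end HookedSeq

open HookedSeq

variable {n d m : ℕ} {p : HookedSeq}

lemma IsPartialConfig.unhook (hp : IsPartialConfig (n + 1) p) :
    IsPartialConfig (n + 1) (HookedSeq.unhook n p) := by
  have hne {d : ℕ} (hd : (HookedSeq.unhook n p).hookEnd d ≠ 0) :
      (HookedSeq.unhook n p).hookEnd d = p.hookEnd d ∧ p.hookEnd d ≠ 0 :=
    have h := unhook_hookEnd_of_ne (entry_hookEnd_ne_of_unhook_hookEnd_ne_zero hd)
    ⟨h, h ▸ hd⟩
  refine ⟨hp.isPermSeq, fun d hd => hp.descent d (hne hd).2, fun d hd => ?_, fun d hd => ?_,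
    fun d l hdl hl => ?_, fun d e hde he hdes => ?_⟩
  · exact (hne hd).1 ▸ hp.lt_hookEnd d (hne hd).2
  · exact (hne hd).1 ▸ hp.hookEnd_lt d (hne hd).2
  · have hd := (hne (Nat.ne_zero_of_lt hl)).1
    rw [hd] at hl ⊢
    exact hp.entry_lt d l hdl hl
  · obtain ⟨hd, hd0⟩ := hne (Nat.ne_zero_of_lt he)
    rw [hd] at he ⊢
    have h := hp.nested d e hde he hdes
    have hlt := hp.entry_lt d _ (hde.le.trans (hp.lt_hookEnd e h.1).le) h.2
    have hle := hp.isPermSeq.apply_lt_iff.2 (hp.hookEnd_lt d hd0)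
    rwa [unhook_hookEnd_of_ne (by omega)]

/-- Nestedness leaves no choice for the southwest endpoint of a hook that ends in column `m`. -/
lemma IsPartialConfig.isGreatest_openDescents_unhook {N : ℕ} (hp : IsPartialConfig N p)
    (hd : p.hookEnd d = m) (hm : m ≠ 0) :
    IsGreatest {e ∈ (HookedSeq.unhook (p.entry m) p).openDescents | e < m} d := by
  subst hd
  refine ⟨⟨⟨hp.descent d hm, unhook_hookEnd_of_eq rfl⟩, hp.lt_hookEnd d hm⟩, ?_⟩
  rintro e ⟨⟨hdes, he0⟩, hem⟩
  by_contra! hde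
  have h := hp.nested d e hde hem hdes
  rcases unhook_hookEnd_eq_zero_iff.1 he0 with h0 | h0
  · exact h.1 h0
  · exact h.2.ne (hp.isPermSeq.injective h0)

lemma IsPartialConfig.eq_of_hookEnd_eq {N : ℕ} (hp : IsPartialConfig N p) {e : ℕ}
    (hd : p.hookEnd d = m) (he : p.hookEnd e = m) (hm : m ≠ 0) : d = e :=
  (hp.isGreatest_openDescents_unhook hd hm).unique (hp.isGreatest_openDescents_unhook he hm)

lemma IsPartialConfig.ncard_openDescents_unhook {N : ℕ} (hp : IsPartialConfig N p)
    (hd : p.hookEnd d = m) (hm : m ≠ 0) :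
    (HookedSeq.unhook (p.entry m) p).openDescents.ncard = p.openDescents.ncard + 1 := by
  have hnot : d ∉ p.openDescents := fun h => hm (hd ▸ h.2)
  rw [← Set.ncard_insert_of_notMem hnot hp.finite_openDescents]
  congr 1
  ext e
  constructor
  · rintro ⟨hdes, he0⟩
    rcases unhook_hookEnd_eq_zero_iff.1 he0 with h0 | h0
    · exact Or.inr ⟨hdes, h0⟩
    · exact Or.inl (hp.eq_of_hookEnd_eq (hp.isPermSeq.injective h0) hd hm)
  · rintro (rfl | ⟨hdes, he0⟩)
    · exact (hp.isGreatest_openDescents_unhook hd hm).1.1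
    · exact ⟨hdes, unhook_hookEnd_eq_zero_iff.2 (Or.inl he0)⟩

lemma IsPartialConfig.addHook_unhook {N : ℕ} (hp : IsPartialConfig N p)
    (hd : p.hookEnd d = m) (hm : m ≠ 0) :
    HookedSeq.addHook d m (HookedSeq.unhook (p.entry m) p) = p := by
  refine HookedSeq.ext rfl (funext fun e => ?_)
  rcases eq_or_ne e d with rfl | hed
  · rw [addHook_hookEnd_self, hd]
  · rw [addHook_hookEnd_of_ne hed]
    by_cases he : p.entry (p.hookEnd e) = p.entry m
    · exact absurd (hp.eq_of_hookEnd_eq (hp.isPermSeq.injective he) hd hm) hed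
    · exact unhook_hookEnd_of_ne he

lemma IsPartialConfig.addHook (hp : IsPartialConfig (n + 1) p) (hm : p.entry m = n)
    (hfree : ¬ p.HooksTo n) (hd : IsGreatest {e ∈ p.openDescents | e < m} d) :
    IsPartialConfig (n + 1) (HookedSeq.addHook d m p) := by
  obtain ⟨⟨⟨hdes, hd0⟩, hdm⟩, hgreatest⟩ := hd
  have hmn := hp.isPermSeq.max_column_le hm
  refine ⟨hp.isPermSeq, fun e he => ?_, fun e he => ?_, fun e he => ?_, fun e l hel hl => ?_,
    fun e g heg hg hgdes => ?_⟩ <;> rcases eq_or_ne e d with rfl | hed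
  · exact hdes
  · exact hp.descent e (by simpa [hed] using he)
  · simpa using hdm
  · simpa [hed] using hp.lt_hookEnd e (by simpa [hed] using he)
  · simpa using Nat.lt_succ_iff.2 hmn
  · simpa [hed] using hp.hookEnd_lt e (by simpa [hed] using he)
  · rw [addHook_hookEnd_self] at hl ⊢
    rw [addHook_entry, hm]
    exact hp.isPermSeq.apply_lt_of_ne_max hm (by omega) hl.ne
  · rw [addHook_hookEnd_of_ne hed] at hl ⊢
    exact hp.entry_lt e l hel hl
  · rw [addHook_hookEnd_self] at hg ⊢
    have hg0 : p.hookEnd g ≠ 0 := fun h0 => not_le.2 heg (hgreatest ⟨⟨hgdes, h0⟩, hg⟩)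
    rw [addHook_hookEnd_of_ne heg.ne']
    refine ⟨hg0, lt_of_le_of_ne ?_ fun h => hfree ⟨g, hg0, h ▸ hm⟩⟩
    by_contra! hlt
    have := hp.entry_lt g m hg.le hlt
    have := hp.isPermSeq.apply_lt_iff.2 (hp.hookEnd_lt g hg0)
    omega
  · rw [addHook_hookEnd_of_ne hed] at hg ⊢
    have h := hp.nested e g heg hg hgdes
    rwa [addHook_hookEnd_of_ne (by rintro rfl; exact h.1 hd0)]

/-- Erasing the hook that ends at the maximum loses nothing: its southwest endpoint was the last
open descent to the left of the maximum. -/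
lemma bijOn_unhook (A : Set (ℕ → ℕ)) (n s : ℕ) :
    Set.BijOn (HookedSeq.unhook n) {p ∈ configs A (n + 1) s | p.HooksTo n}
      {p ∈ freeConfigs A n (s + 1) | p.HasOpenBefore n} := by
  refine ⟨?_, ?_, ?_⟩
  · rintro p ⟨⟨hp, hA, hs⟩, d, hd, rfl⟩
    have hopen := (hp.isGreatest_openDescents_unhook rfl hd).1
    exact ⟨⟨⟨hp.unhook, hA, hs ▸ hp.ncard_openDescents_unhook rfl hd⟩, not_hooksTo_unhook⟩,
      d, hopen.1, _, hopen.2, rfl⟩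
  · rintro p ⟨⟨hp, -⟩, d, hd, hdn⟩ q ⟨⟨hq, -⟩, e, he, hen⟩ h
    have hentry : p.entry = q.entry := by simpa using congrArg entry h
    have hm : q.hookEnd e = p.hookEnd d := hq.isPermSeq.injective (by rw [hen, ← hentry, hdn])
    have hp' := hp.isGreatest_openDescents_unhook rfl hd
    have hq' := hq.isGreatest_openDescents_unhook hm hd
    have hpq := hp.addHook_unhook rfl hd
    rw [← hentry] at hq'
    rw [hdn, h, ← hdn] at hp' hpq
    obtain rfl := hp'.unique hq'
    rw [hentry] at hpq
    exact hpq.symm.trans (hq.addHook_unhook hm hd)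
  · rintro p ⟨⟨⟨hp, hA, hs⟩, hfree⟩, d, hd, m, hdm, hm⟩
    obtain ⟨e, he⟩ : ∃ e, IsGreatest {e ∈ p.openDescents | e < m} e :=
      BddAbove.exists_isGreatest_of_nonempty ⟨m, fun e he => he.2.le⟩ ⟨d, hd, hdm⟩
    have hun := unhook_addHook hm he.1.1.2 hfree
    have hadd := hp.addHook hm hfree he
    have hm0 : m ≠ 0 := Nat.ne_zero_of_lt hdm
    have hcard := hadd.ncard_openDescents_unhook addHook_hookEnd_self hm0
    rw [addHook_entry, hm, hun, hs] at hcard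
    refine ⟨addHook e m p, ⟨⟨hadd, hA, by omega⟩, e, ?_⟩, hun⟩
    rw [addHook_hookEnd_self]
    exact ⟨hm0, hm⟩

lemma ncard_configs_succ (A : Set (ℕ → ℕ)) (n s : ℕ) :
    (configs A (n + 1) s).ncard = (freeConfigs A n s).ncard +
      {p ∈ freeConfigs A n (s + 1) | p.HasOpenBefore n}.ncard := by
  rw [← Set.ncard_inter_add_ncard_sdiff_eq_ncard _ {p : HookedSeq | p.HooksTo n}
    (finite_configs A (n + 1) s), add_comm]
  exact congrArg _ (bijOn_unhook A n s).ncard_eq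

end maxHook

/-! ### Maximum in the last or in the first column -/

section maxPosition

open HookedSeq

variable {A : Set (ℕ → ℕ)} {n m s : ℕ} {p : HookedSeq}

lemma IsPartialConfig.iff_succ : IsPartialConfig n p ↔
    IsPartialConfig (n + 1) p ∧ p.entry n = n ∧ ¬ p.HooksTo n := by
  constructor
  · intro hp
    refine ⟨⟨hp.isPermSeq.succ, hp.descent, hp.lt_hookEnd,
      fun d hd => Nat.lt_succ_of_lt (hp.hookEnd_lt d hd), hp.entry_lt, hp.nested⟩,
      hp.isPermSeq.apply_of_le n le_rfl, ?_⟩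
    rintro ⟨d, hd, hn⟩
    exact absurd (hp.isPermSeq.apply_lt_iff.2 (hp.hookEnd_lt d hd)) hn.not_lt
  · rintro ⟨hp, hn, hfree⟩
    refine ⟨IsPermSeq.iff_succ_and_apply_eq.2 ⟨hp.isPermSeq, hn⟩, hp.descent, hp.lt_hookEnd,
      fun d hd => ?_, hp.entry_lt, hp.nested⟩
    exact (Nat.lt_succ_iff.1 (hp.hookEnd_lt d hd)).lt_of_ne fun h => hfree ⟨d, hd, h.symm ▸ hn⟩

lemma freeConfigs_inter_maxAt_self (A : Set (ℕ → ℕ)) (n s : ℕ) :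
    freeConfigs (A ∩ maxAt n n) n s = configs A n s := by
  ext p
  constructor
  · rintro ⟨⟨hp, ⟨hA, hn⟩, hs⟩, hfree⟩
    exact ⟨IsPartialConfig.iff_succ.2 ⟨hp, hn, hfree⟩, hA, hs⟩
  · rintro ⟨hp, hA, hs⟩
    obtain ⟨hp', hn, hfree⟩ := IsPartialConfig.iff_succ.1 hp
    exact ⟨⟨hp', ⟨hA, hn⟩, hs⟩, hfree⟩

lemma ncard_configs_inter_maxAt_self (A : Set (ℕ → ℕ)) (n s : ℕ) :
    (configs (A ∩ maxAt n n) (n + 1) s).ncard =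
      (configs A n s).ncard + (configs A n (s + 1)).ncard := by
  rw [ncard_configs_succ, freeConfigs_inter_maxAt_self, freeConfigs_inter_maxAt_self,
    Set.sep_eq_self_iff_mem_true.2]
  rintro p ⟨hp, -, hs⟩
  obtain ⟨d, hd⟩ := Set.nonempty_of_ncard_ne_zero (hs.trans_ne s.succ_ne_zero)
  exact ⟨d, hd, n, hp.openDescents_subset_Iio hd, hp.isPermSeq.apply_of_le n le_rfl⟩

lemma IsPartialConfig.mem_openDescents_max (hp : IsPartialConfig (n + 1) p) (hm : p.entry m = n)
    (hmn : m < n) : m ∈ p.openDescents := by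
  refine ⟨hm ▸ hp.isPermSeq.apply_lt_of_ne_max hm hmn (Nat.succ_ne_self m), ?_⟩
  by_contra h
  have := hp.entry_lt m m le_rfl (hp.lt_hookEnd m h)
  have := hp.isPermSeq.apply_lt_iff.2 (hp.hookEnd_lt m h)
  omega

lemma configs_sdiff_maxAt_self_zero (A : Set (ℕ → ℕ)) (n : ℕ) :
    configs (A \ maxAt n n) (n + 1) 0 = ∅ := by
  refine Set.eq_empty_of_forall_notMem fun p ⟨hp, ⟨_, hn⟩, hs⟩ => ?_
  obtain ⟨m, hmn, hm⟩ := hp.isPermSeq.exists_apply_eq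
  have hlt : m < n := hmn.lt_of_ne (by rintro rfl; exact hn hm)
  rw [Set.ncard_eq_zero hp.finite_openDescents] at hs
  exact hs.le (hp.mem_openDescents_max hm hlt)

lemma ncard_configs_succ_zero (A : Set (ℕ → ℕ)) (n : ℕ) :
    (configs A (n + 1) 0).ncard = (configs A n 0).ncard + (configs A n 1).ncard := by
  rw [← ncard_configs_inter_add_sdiff A (maxAt n n), configs_sdiff_maxAt_self_zero,
    Set.ncard_empty, add_zero, ncard_configs_inter_maxAt_self]

/-- A class of sequences such that prepending a new maximum to a permutation does not affect
membership. -/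
def IsMaxPrependStable (A : Set (ℕ → ℕ)) : Prop :=
  ∀ ⦃n σ⦄, IsPermSeq n σ → (prependEntry n σ ∈ A ↔ σ ∈ A)

lemma configs_inter_maxAt_zero (hA : IsMaxPrependStable A) (hn : n ≠ 0) (s : ℕ) :
    configs (A ∩ maxAt n 0) (n + 1) (s + 1) = prepend n '' configs A n s := by
  have hopen {q : HookedSeq} (hq : IsPartialConfig n q) :
      (prepend n q).openDescents.ncard = q.openDescents.ncard + 1 :=
    ncard_openDescents_prepend_of_lt hq.finite_openDescents
      (hq.isPermSeq.apply_lt_iff.2 (Nat.pos_of_ne_zero hn))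
  ext p
  constructor
  · rintro ⟨hp, ⟨hpA, h0⟩, hs⟩
    obtain ⟨v, q, rfl⟩ :=
      hp.exists_prepend_eq (hp.mem_openDescents_max h0 (Nat.pos_of_ne_zero hn)).2
    obtain rfl : v = n := h0
    have hq := hp.of_prepend
    rw [hopen hq] at hs
    exact ⟨q, ⟨hq, (hA hq.isPermSeq).1 hpA, by omega⟩, rfl⟩
  · rintro ⟨q, ⟨hq, hqA, hs⟩, rfl⟩
    exact ⟨hq.prepend le_rfl, ⟨(hA hq.isPermSeq).2 hqA, rfl⟩, hs ▸ hopen hq⟩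

/-- The sequences in `A` with value `n` neither in column `0` nor in column `n`. -/
def maxInside (A : Set (ℕ → ℕ)) (n : ℕ) : Set (ℕ → ℕ) := (A \ maxAt n n) \ maxAt n 0

lemma IsPartialConfig.exists_max_inside (hp : IsPartialConfig (n + 1) p)
    (hA : p.entry ∈ maxInside A n) : ∃ m, 0 < m ∧ m < n ∧ p.entry m = n := by
  obtain ⟨m, hmn, hm⟩ := hp.isPermSeq.exists_apply_eq
  exact ⟨m, Nat.pos_of_ne_zero (by rintro rfl; exact hA.2 hm),
    hmn.lt_of_ne (by rintro rfl; exact hA.1.2 hm), hm⟩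

lemma ncard_configs_succ_succ (hA : IsMaxPrependStable A) (hn : n ≠ 0) (s : ℕ) :
    (configs A (n + 1) (s + 1)).ncard =
      (configs A n (s + 1)).ncard + (configs A n (s + 2)).ncard + (configs A n s).ncard +
        (configs (maxInside A n) (n + 1) (s + 1)).ncard := by
  have hfirst : configs ((A \ maxAt n n) ∩ maxAt n 0) (n + 1) (s + 1) =
      configs (A ∩ maxAt n 0) (n + 1) (s + 1) := by
    ext p
    refine and_congr_right fun hp => and_congr_left fun _ => and_congr_left fun h0 => ?_
    exact and_iff_left fun h => hn (hp.isPermSeq.injective (h.trans h0.symm))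
  rw [← ncard_configs_inter_add_sdiff A (maxAt n n), ncard_configs_inter_maxAt_self,
    ← ncard_configs_inter_add_sdiff (A \ maxAt n n) (maxAt n 0), hfirst,
    configs_inter_maxAt_zero hA hn, Set.ncard_image_of_injective _ (prepend_injective n),
    maxInside]
  ring

lemma configs_maxInside_avoiders231And132 (n s : ℕ) :
    configs (maxInside avoiders231And132 n) (n + 1) s = ∅ := by
  refine Set.eq_empty_of_forall_notMem fun p ⟨hp, hA, _⟩ => ?_
  obtain ⟨m, h0m, hmn, hm⟩ := hp.exists_max_inside hA
  exact hA.1.1.2 h0m hmn (hA.1.1.1.lt_of_lt_max hp.isPermSeq hm h0m hmn)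
    (hm ▸ hp.isPermSeq.apply_lt_of_ne_max hm le_rfl hmn.ne')

/-! ### Maximum inside -/

lemma configs_maxInside_of_le_one (A : Set (ℕ → ℕ)) (hn : n ≤ 1) (s : ℕ) :
    configs (maxInside A n) (n + 1) s = ∅ := by
  refine Set.eq_empty_of_forall_notMem fun p ⟨hp, hA, _⟩ => ?_
  obtain ⟨m, h0m, hmn, -⟩ := hp.exists_max_inside hA
  omega

lemma ncard_freeConfigs_maxInside_zero (A : Set (ℕ → ℕ)) (n : ℕ) :
    (freeConfigs (maxInside A n) n 0).ncard = 0 := by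
  convert Set.ncard_empty HookedSeq
  refine Set.eq_empty_of_forall_notMem fun p ⟨⟨hp, hA, hs⟩, _⟩ => ?_
  exact (configs_sdiff_maxAt_self_zero A n).le ⟨hp, hA.1, hs⟩

lemma IsPartialConfig.hookEnd_zero_eq_zero (hp : IsPartialConfig (n + 1) p)
    (hA : p.entry ∈ avoiders231And1243) (hm : p.entry m = n) (hmn : m < n)
    (hfree : ¬ p.HooksTo n) : p.hookEnd 0 = 0 := by
  by_contra h
  have h0 := hp.lt_hookEnd 0 h
  rcases lt_trichotomy (p.hookEnd 0) m with hlt | heq | hgt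
  · exact lt_asymm (hp.entry_lt 0 0 le_rfl h0)
      (apply_lt_apply_of_lt_max hA hp.isPermSeq hm hmn h0 hlt)
  · exact hfree ⟨0, h, heq ▸ hm⟩
  · have := hp.entry_lt 0 m m.zero_le hgt
    have := hp.isPermSeq.apply_lt_iff.2 (hp.hookEnd_lt 0 h)
    omega

lemma hasOpenBefore_iff_entry_one_ne (hp : p ∈ freeConfigs (maxInside avoiders231And1243 n) n s) :
    p.HasOpenBefore n ↔ p.entry 1 ≠ n := by
  obtain ⟨⟨hp, hA, -⟩, hfree⟩ := hp
  constructor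
  · rintro ⟨d, hd, m, hdm, hm⟩ h1
    obtain rfl : m = 1 := hp.isPermSeq.injective (hm.trans h1.symm)
    obtain rfl : d = 0 := Nat.lt_one_iff.1 hdm
    have := hp.isPermSeq.apply_lt_of_ne_max h1 n.zero_le zero_ne_one
    exact lt_asymm hd.1 (h1.symm ▸ this)
  · intro h1
    obtain ⟨m, h0m, hmn, hm⟩ := hp.exists_max_inside hA
    have h1m : 1 < m := Nat.lt_of_le_of_ne h0m (by rintro rfl; exact h1 hm)
    exact ⟨0, ⟨apply_lt_apply_of_lt_max hA.1.1 hp.isPermSeq hm hmn one_pos h1m,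
      hp.hookEnd_zero_eq_zero hA.1.1 hm hmn hfree⟩, m, h0m, hm⟩

lemma prepend_mem_freeConfigs_maxInside_iff {v : ℕ} (hv : v ≤ n) :
    prepend v p ∈ freeConfigs (maxInside A (n + 1)) (n + 1) s ↔
      IsPartialConfig (n + 1) p ∧ prependEntry v p.entry ∈ A ∧ p.entry n ≠ n ∧
        (prepend v p).openDescents.ncard = s ∧ ¬ p.HooksTo n := by
  have hlast : prependEntry v p.entry ∈ maxAt (n + 1) (n + 1) ↔ p.entry n = n :=
    prependEntry_succ_eq_succ_iff hv
  have hfirst : prependEntry v p.entry ∉ maxAt (n + 1) 0 := (Nat.lt_succ_of_le hv).ne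
  simp only [freeConfigs, configs, maxInside, Set.mem_ofPred_eq, Set.mem_sdiff, prepend_entry,
    hooksTo_prepend_iff hv, hlast, hfirst, not_false_eq_true, and_true, ne_eq]
  have : IsPartialConfig (n + 1 + 1) (prepend v p) ↔ IsPartialConfig (n + 1) p :=
    ⟨fun h => h.of_prepend, fun h => h.prepend (by omega)⟩
  tauto

lemma freeConfigs_entry_one_ne (n s : ℕ) :
    {p ∈ freeConfigs (maxInside avoiders231And1243 (n + 1)) (n + 1) (s + 1) | p.entry 1 ≠ n + 1} =
      (fun q => prepend (q.entry 0 + 1) q) '' freeConfigs (maxInside avoiders231And1243 n) n s := by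
  ext p
  constructor
  · rintro ⟨hpfree, h1⟩
    obtain ⟨⟨hp, hA, -⟩, hfree⟩ := id hpfree
    obtain ⟨m, h0m, hmn, hm⟩ := hp.exists_max_inside hA
    have h1m : 1 < m := Nat.lt_of_le_of_ne h0m (by rintro rfl; exact h1 hm)
    have h01 := apply_zero_eq_apply_one_add_one hA.1.1 hp.isPermSeq hm hmn h1m
    have h0 := hp.isPermSeq.apply_lt_of_ne_max hm (Nat.zero_le _) h0m.ne
    obtain ⟨v, q, rfl⟩ := hp.exists_prepend_eq (hp.hookEnd_zero_eq_zero hA.1.1 hm hmn hfree)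
    obtain rfl : v = q.entry 0 + 1 := by
      change v = prependEntry v q.entry (0 + 1) + 1 at h01
      rw [prependEntry_succ] at h01
      split_ifs at h01 <;> omega
    have hv : q.entry 0 + 1 ≤ n := Nat.lt_succ_iff.1 h0
    obtain ⟨hq, hqA, hqn, hs, hqfree⟩ := (prepend_mem_freeConfigs_maxInside_iff hv).1 hpfree
    rw [ncard_openDescents_prepend_of_lt hq.finite_openDescents (lt_add_one _)] at hs
    have hq0 := mt (prependEntry_succ_eq_succ_iff hv).2 h1
    exact ⟨q, ⟨⟨hq, ⟨⟨(prependEntry_succ_mem_avoiders231And1243_iff hq.isPermSeq.injective).1 hqA,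
      hqn⟩, hq0⟩, by omega⟩, hqfree⟩, rfl⟩
  · rintro ⟨q, ⟨⟨hq, hA, hs⟩, hfree⟩, rfl⟩
    have hv : q.entry 0 + 1 ≤ n :=
      (Nat.lt_succ_iff.1 (hq.isPermSeq.apply_lt_iff.2 n.succ_pos)).lt_of_ne hA.2
    refine ⟨(prepend_mem_freeConfigs_maxInside_iff hv).2 ⟨hq,
      (prependEntry_succ_mem_avoiders231And1243_iff hq.isPermSeq.injective).2 hA.1.1, hA.1.2, ?_,
      hfree⟩, mt (prependEntry_succ_eq_succ_iff hv).1 hA.2⟩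
    rw [ncard_openDescents_prepend_of_lt hq.finite_openDescents (lt_add_one _), hs]

lemma ncard_freeConfigs_entry_one_ne (n s : ℕ) :
    {p ∈ freeConfigs (maxInside avoiders231And1243 (n + 1)) (n + 1) (s + 1) |
      p.entry 1 ≠ n + 1}.ncard = (freeConfigs (maxInside avoiders231And1243 n) n s).ncard := by
  rw [freeConfigs_entry_one_ne]
  refine Set.ncard_image_of_injective _ fun q r h => ?_
  have hv : q.entry 0 + 1 = r.entry 0 + 1 := congrFun (congrArg entry h) 0
  exact prepend_injective _ (h.trans (by rw [hv]))

lemma freeConfigs_entry_one_eq (hn : n ≠ 0) (s : ℕ) :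
    {p ∈ freeConfigs (maxInside avoiders231And1243 (n + 1)) (n + 1) s | p.entry 1 = n + 1} =
      prepend 0 '' configs (avoiders231And132 ∩ maxAt n 0) (n + 1) s := by
  ext p
  constructor
  · rintro ⟨hpfree, h1⟩
    obtain ⟨⟨hp, hA, -⟩, -⟩ := id hpfree
    have h0 := hA.1.1.1.apply_zero_eq_zero hp.isPermSeq h1 n.succ_pos
    have hhook : p.hookEnd 0 = 0 := not_not.1 fun h => by simpa [h0] using hp.descent 0 h
    obtain ⟨v, q, rfl⟩ := hp.exists_prepend_eq hhook
    obtain rfl : v = 0 := h0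
    obtain ⟨hq, hqA, -, hs, -⟩ := (prepend_mem_freeConfigs_maxInside_iff n.zero_le).1 hpfree
    rw [ncard_openDescents_prepend_of_le (Nat.zero_le _)] at hs
    exact ⟨q, ⟨hq, ⟨prependEntry_zero_mem_avoiders231And1243_iff.1 hqA,
      (prependEntry_succ_eq_succ_iff n.zero_le).1 h1⟩, hs⟩, rfl⟩
  · rintro ⟨q, ⟨hq, ⟨hA, h0⟩, hs⟩, rfl⟩
    refine ⟨(prepend_mem_freeConfigs_maxInside_iff n.zero_le).2 ⟨hq,
      prependEntry_zero_mem_avoiders231And1243_iff.2 hA,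
      fun hqn => hn (hq.isPermSeq.injective (hqn.trans h0.symm)),
      hs ▸ ncard_openDescents_prepend_of_le (Nat.zero_le _), ?_⟩,
      (prependEntry_succ_eq_succ_iff n.zero_le).2 h0⟩
    rintro ⟨d, hd, hdn⟩
    exact hd (hq.isPermSeq.injective (hdn.trans h0.symm))

lemma isMaxPrependStable_avoiders231And1243 : IsMaxPrependStable avoiders231And1243 :=
  fun _ _ hσ => hσ.prependEntry_mem_avoiders231And1243_iff

lemma isMaxPrependStable_avoiders231And132 : IsMaxPrependStable avoiders231And132 :=
  fun _ _ hσ => hσ.prependEntry_mem_avoiders231And132_iff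

lemma finite_freeConfigs (A : Set (ℕ → ℕ)) (n s : ℕ) : (freeConfigs A n s).Finite :=
  (finite_configs A (n + 1) s).subset fun _ hp => hp.1

lemma ncard_freeConfigs_entry_one_eq (hn : n ≠ 0) (s : ℕ) :
    {p ∈ freeConfigs (maxInside avoiders231And1243 (n + 1)) (n + 1) (s + 1) |
      p.entry 1 = n + 1}.ncard = (configs avoiders231And132 n s).ncard := by
  rw [freeConfigs_entry_one_eq hn, Set.ncard_image_of_injective _ (prepend_injective 0),
    configs_inter_maxAt_zero isMaxPrependStable_avoiders231And132 hn,
    Set.ncard_image_of_injective _ (prepend_injective n)]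

lemma ncard_freeConfigs_maxInside_succ_succ (hn : n ≠ 0) (s : ℕ) :
    (freeConfigs (maxInside avoiders231And1243 (n + 1)) (n + 1) (s + 1)).ncard =
      (configs avoiders231And132 n s).ncard +
        (freeConfigs (maxInside avoiders231And1243 n) n s).ncard := by
  rw [← ncard_freeConfigs_entry_one_ne n s, ← ncard_freeConfigs_entry_one_eq hn s]
  exact (Set.ncard_inter_add_ncard_sdiff_eq_ncard _ {p : HookedSeq | p.entry 1 = n + 1}
    (finite_freeConfigs _ _ _)).symm

lemma ncard_configs_maxInside_succ (n s : ℕ) :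
    (configs (maxInside avoiders231And1243 (n + 1)) (n + 2) s).ncard =
      (freeConfigs (maxInside avoiders231And1243 (n + 1)) (n + 1) s).ncard +
        (freeConfigs (maxInside avoiders231And1243 n) n s).ncard := by
  have hopen : {p ∈ freeConfigs (maxInside avoiders231And1243 (n + 1)) (n + 1) (s + 1) |
      p.HasOpenBefore (n + 1)} = {p ∈ freeConfigs (maxInside avoiders231And1243 (n + 1)) (n + 1)
        (s + 1) | p.entry 1 ≠ n + 1} :=
    Set.ext fun _ => and_congr_right hasOpenBefore_iff_entry_one_ne
  rw [ncard_configs_succ, hopen, ncard_freeConfigs_entry_one_ne]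

end maxPosition

/-! ### Generating functions -/

section series

open PowerSeries

section MotzkinRecurrence

variable {R : Type*} [CommRing R] {a f g : ℕ → R⟦X⟧} {t : R⟦X⟧}

/-- The recurrence satisfied by the generating functions, by length, of Motzkin paths that end at
height `s` (a step down, a level step or a step up), with an additional source term `a`. -/
def IsMotzkinSolution (a f : ℕ → R⟦X⟧) : Prop :=
  f 0 = X * (f 0 + f 1) + a 0 ∧
    ∀ s, f (s + 1) = X * (f (s + 1) + f (s + 2) + f s) + a (s + 1)

lemma IsMotzkinSolution.eq (hf : IsMotzkinSolution a f) (hg : IsMotzkinSolution a g) : f = g := by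
  have coeff_eq (n : ℕ) : ∀ s, coeff n (f s) = coeff n (g s) := by
    induction n with
    | zero =>
      rintro (_ | s)
      · rw [hf.1, hg.1]; simp
      · rw [hf.2, hg.2]; simp
    | succ n ih =>
      rintro (_ | s)
      · rw [hf.1, hg.1]; simp [coeff_succ_X_mul, ih]
      · rw [hf.2, hg.2]; simp [coeff_succ_X_mul, ih]
  exact funext fun s => PowerSeries.ext fun n => coeff_eq n s

lemma IsMotzkinSolution.const_mul (hf : IsMotzkinSolution a f) (r : R⟦X⟧) :
    IsMotzkinSolution (fun s => r * a s) fun s => r * f s := by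
  refine ⟨?_, fun s => ?_⟩
  · linear_combination r * hf.1
  · linear_combination r * hf.2 s

lemma isMotzkinSolution_single (ht : t = X * (1 + t + t ^ 2)) :
    IsMotzkinSolution (Pi.single 0 1) fun s => (1 + t + t ^ 2) * t ^ s := by
  refine ⟨?_, fun s => ?_⟩
  · rw [Pi.single_eq_same]
    linear_combination (1 + t) * ht
  · rw [Pi.single_eq_of_ne s.succ_ne_zero]
    linear_combination t ^ s * (1 + t + t ^ 2) * ht

lemma isMotzkinSolution_geom_sum₂ (ht : t = X * (1 + t + t ^ 2)) :
    IsMotzkinSolution (fun s => (1 - t) * ((Pi.single 0 1 : ℕ → R⟦X⟧) s +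
        (1 + X) * (X * t * ∑ i ∈ Finset.range s, t ^ i * X ^ (s - 1 - i))))
      fun s => (s + 1 : R⟦X⟧) * t ^ s -
        (1 - t) * t * ∑ i ∈ Finset.range s, t ^ i * X ^ (s - 1 - i) := by
  set D : ℕ → R⟦X⟧ := fun s => ∑ i ∈ Finset.range s, t ^ i * X ^ (s - 1 - i) with hD
  have D_zero : D 0 = 0 := Finset.sum_range_zero _
  have D_succ (s : ℕ) : D (s + 1) = t ^ s + X * D s := by
    simp only [hD]
    rw [Nat.add_sub_cancel, geom_sum₂_succ_eq]
  change IsMotzkinSolution (fun s => (1 - t) * ((Pi.single 0 1 : ℕ → R⟦X⟧) s +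
    (1 + X) * (X * t * D s))) fun s => (s + 1 : R⟦X⟧) * t ^ s - (1 - t) * t * D s
  refine ⟨?_, fun s => ?_⟩ <;> beta_reduce
  · rw [Pi.single_eq_same, D_succ, D_zero]
    push_cast
    linear_combination ht
  · rw [Pi.single_eq_of_ne s.succ_ne_zero, D_succ (s + 1), D_succ]
    push_cast
    linear_combination ((s + 1) * t ^ s + t ^ (s + 1)) * ht

end MotzkinRecurrence

/-- The generating function of the nonempty partial configurations with underlying sequence in `A`
and `s` open descents; `xⁿ` counts those of length `n + 1`. -/
noncomputable def configSeries (A : Set (ℕ → ℕ)) (s : ℕ) : ℚ⟦X⟧ :=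
  mk fun n => ((configs A (n + 1) s).ncard : ℚ)

/-- The part of `configSeries A s` in which the maximum is neither the first nor the last entry. -/
noncomputable def maxInsideSeries (A : Set (ℕ → ℕ)) (s : ℕ) : ℚ⟦X⟧ :=
  mk fun n => ((configs (maxInside A n) (n + 1) s).ncard : ℚ)

/-- The part of `maxInsideSeries A s` in which no hook ends at the maximum. -/
noncomputable def freeMaxInsideSeries (A : Set (ℕ → ℕ)) (s : ℕ) : ℚ⟦X⟧ :=
  mk fun n => ((freeConfigs (maxInside A n) n s).ncard : ℚ)

variable {A : Set (ℕ → ℕ)} {n : ℕ} {t : ℚ⟦X⟧}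

lemma isMotzkinSolution_configSeries (hA : IsMaxPrependStable A) (hid : id ∈ A) :
    IsMotzkinSolution (Pi.single 0 1 + maxInsideSeries A) (configSeries A) := by
  have hinside (n : ℕ) : configs (maxInside A n) (n + 1) 0 = ∅ :=
    Set.subset_eq_empty (fun _ hp => ⟨hp.1, hp.2.1.1, hp.2.2⟩ :
      _ ⊆ configs (A \ maxAt n n) (n + 1) 0) (configs_sdiff_maxAt_self_zero A n)
  refine ⟨PowerSeries.ext fun n => ?_, fun s => PowerSeries.ext fun n => ?_⟩
  · cases n with
    | zero => simp [configSeries, maxInsideSeries, ncard_configs_of_le_one hid, hinside]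
    | succ n =>
      simp [configSeries, maxInsideSeries, ncard_configs_succ_zero A (n + 1), hinside,
        coeff_succ_X_mul, coeff_one]
  · cases n with
    | zero =>
      simp [configSeries, maxInsideSeries, ncard_configs_of_le_one hid,
        configs_maxInside_of_le_one]
    | succ n =>
      simp [configSeries, maxInsideSeries, ncard_configs_succ_succ hA n.succ_ne_zero,
        coeff_succ_X_mul]

lemma configSeries_avoiders231And132 (ht : t = X * (1 + t + t ^ 2)) (s : ℕ) :
    configSeries avoiders231And132 s = (1 + t + t ^ 2) * t ^ s := by
  have hinside : maxInsideSeries avoiders231And132 = 0 := by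
    ext s n
    simp [maxInsideSeries, configs_maxInside_avoiders231And132]
  have hsol := isMotzkinSolution_configSeries isMaxPrependStable_avoiders231And132
    id_mem_avoiders231And132
  rw [hinside, add_zero] at hsol
  exact congrFun (hsol.eq (isMotzkinSolution_single ht)) s

lemma freeConfigs_maxInside_of_le_one (A : Set (ℕ → ℕ)) (hn : n ≤ 1) (s : ℕ) :
    freeConfigs (maxInside A n) n s = ∅ :=
  Set.subset_eq_empty (fun _ hp => hp.1) (configs_maxInside_of_le_one A hn s)

lemma freeMaxInsideSeries_zero (A : Set (ℕ → ℕ)) : freeMaxInsideSeries A 0 = 0 := by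
  ext n
  simp [freeMaxInsideSeries, ncard_freeConfigs_maxInside_zero]

lemma freeMaxInsideSeries_succ (s : ℕ) :
    freeMaxInsideSeries avoiders231And1243 (s + 1) =
      X * (X * configSeries avoiders231And132 s + freeMaxInsideSeries avoiders231And1243 s) := by
  ext (_ | _ | n)
  · simp [freeMaxInsideSeries, freeConfigs_maxInside_of_le_one]
  · simp [freeMaxInsideSeries, freeConfigs_maxInside_of_le_one, coeff_succ_X_mul]
  · simp [freeMaxInsideSeries, configSeries, coeff_succ_X_mul,
      ncard_freeConfigs_maxInside_succ_succ n.succ_ne_zero]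

lemma freeMaxInsideSeries_eq (ht : t = X * (1 + t + t ^ 2)) (s : ℕ) :
    freeMaxInsideSeries avoiders231And1243 s =
      X * t * ∑ i ∈ Finset.range s, t ^ i * X ^ (s - 1 - i) := by
  induction s with
  | zero => simp [freeMaxInsideSeries_zero]
  | succ s ih =>
    rw [freeMaxInsideSeries_succ, ih, configSeries_avoiders231And132 ht, Nat.add_sub_cancel,
      geom_sum₂_succ_eq]
    linear_combination -X * t ^ s * ht

lemma maxInsideSeries_eq (s : ℕ) : maxInsideSeries avoiders231And1243 s =
    (1 + X) * freeMaxInsideSeries avoiders231And1243 s := by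
  ext (_ | n)
  · simp [maxInsideSeries, freeMaxInsideSeries, configs_maxInside_of_le_one,
      freeConfigs_maxInside_of_le_one]
  · simp [maxInsideSeries, freeMaxInsideSeries, ncard_configs_maxInside_succ, add_mul,
      coeff_succ_X_mul]

lemma one_sub_mul_configSeries_zero (ht : t = X * (1 + t + t ^ 2)) :
    (1 - t) * configSeries avoiders231And1243 0 = 1 := by
  have hsol := (isMotzkinSolution_configSeries isMaxPrependStable_avoiders231And1243
    id_mem_avoiders231And1243).const_mul (1 - t)
  simp only [Pi.add_apply, maxInsideSeries_eq, freeMaxInsideSeries_eq ht] at hsol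
  simpa using congrFun (hsol.eq (isMotzkinSolution_geom_sum₂ ht)) 0

/-! ### The square root -/

lemma exists_sq_eq_one_add_C_mul_X (a : ℚ) :
    ∃ S : ℚ⟦X⟧, constantCoeff S = 1 ∧ S ^ 2 = 1 + C a * X := by
  have hsq : PowerSeries.binomialSeries ℚ (1 / 2 : ℚ) ^ 2 = 1 + X := by
    rw [sq, ← PowerSeries.binomialSeries_add, add_halves]
    simpa using PowerSeries.binomialSeries_nat (R := ℚ) (A := ℚ) 1
  refine ⟨rescale a (PowerSeries.binomialSeries ℚ (1 / 2 : ℚ)), ?_, ?_⟩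
  · rw [← coeff_zero_eq_constantCoeff_apply, coeff_rescale]
    simp
  · rw [← map_pow, hsq, map_add, map_one, rescale_X]

lemma exists_sq_eq_one_sub_two_mul_X_sub :
    ∃ S : ℚ⟦X⟧, constantCoeff S = 1 ∧ S ^ 2 = 1 - 2 * X - 3 * X ^ 2 := by
  obtain ⟨S, hS0, hS⟩ := exists_sq_eq_one_add_C_mul_X 1
  obtain ⟨T, hT0, hT⟩ := exists_sq_eq_one_add_C_mul_X (-3)
  refine ⟨S * T, by rw [map_mul, hS0, hT0, one_mul], ?_⟩
  rw [mul_pow, hS, hT, map_one, map_neg, map_ofNat]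
  ring

lemma exists_eq_one_sub_X_sub_two_mul_X_mul {S : ℚ⟦X⟧} (hS0 : constantCoeff S = 1)
    (hS : S ^ 2 = 1 - 2 * X - 3 * X ^ 2) :
    ∃ t : ℚ⟦X⟧, t = X * (1 + t + t ^ 2) ∧ S = 1 - X - 2 * X * t := by
  obtain ⟨u, hu⟩ : X ∣ 1 - X - S := by
    rw [X_dvd_iff]
    simp [hS0]
  obtain ⟨t, rfl⟩ : ∃ t, u = 2 * t :=
    ⟨C (1 / 2) * u, by rw [← mul_assoc, ← map_ofNat C 2, ← map_mul]; norm_num⟩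
  have hSt : S = 1 - X - 2 * X * t := by linear_combination -hu
  have : CharZero ℚ⟦X⟧ := algebraRat.charZero _
  refine ⟨t, mul_left_cancel₀ (mul_ne_zero (OfNat.ofNat_ne_zero 4) X_ne_zero) ?_, hSt⟩
  rw [hSt] at hS
  linear_combination -hS

end series

/-! ### Valid hook configurations as partial configurations -/

section patterns

variable {n : ℕ} {π : Equiv.Perm (Fin n)}

lemma contains_iff_strictMono {m : ℕ} {τ : Equiv.Perm (Fin m)} :
    Contains π τ ↔ ∃ f : Fin m → Fin n, StrictMono f ∧ StrictMono (π ∘ f ∘ τ.symm) := by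
  constructor
  · rintro ⟨f, hf⟩
    refine ⟨f, f.strictMono, fun a b hab => (hf _ _).2 ?_⟩
    simpa only [Equiv.apply_symm_apply] using hab
  · rintro ⟨f, hf, hπ⟩
    refine ⟨OrderEmbedding.ofStrictMono f hf, fun a b => ?_⟩
    simpa only [Function.comp_apply, Equiv.symm_apply_apply, OrderEmbedding.coe_ofStrictMono] using
      hπ.lt_iff_lt (a := τ a) (b := τ b)

lemma contains_p231_iff :
    Contains π p231 ↔ ∃ i j k, i < j ∧ j < k ∧ π k < π i ∧ π i < π j := by
  rw [contains_iff_strictMono]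
  constructor
  · rintro ⟨f, hf, hπ⟩
    exact ⟨f 0, f 1, f 2, hf (by decide), hf (by decide),
      hπ (show (0 : Fin 3) < 1 by decide), hπ (show (1 : Fin 3) < 2 by decide)⟩
  · rintro ⟨i, j, k, hij, hjk, hki, hij'⟩
    have hcomp : π ∘ ![i, j, k] ∘ p231.symm = ![π k, π i, π j] := by
      ext a
      fin_cases a <;> rfl
    refine ⟨![i, j, k], by simp [hij, hjk], ?_⟩
    simp [hcomp, hki, hij']

lemma contains_p1243_iff : Contains π p1243 ↔
    ∃ i j k l, i < j ∧ j < k ∧ k < l ∧ π i < π j ∧ π j < π l ∧ π l < π k := by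
  rw [contains_iff_strictMono]
  constructor
  · rintro ⟨f, hf, hπ⟩
    exact ⟨f 0, f 1, f 2, f 3, hf (by decide), hf (by decide), hf (by decide),
      hπ (show (0 : Fin 4) < 1 by decide), hπ (show (1 : Fin 4) < 2 by decide),
      hπ (show (2 : Fin 4) < 3 by decide)⟩
  · rintro ⟨i, j, k, l, hij, hjk, hkl, hij', hjl, hlk⟩
    have hcomp : π ∘ ![i, j, k, l] ∘ p1243.symm = ![π i, π j, π l, π k] := by
      ext a
      fin_cases a <;> rfl
    refine ⟨![i, j, k, l], by simp [hij, hjk, hkl], ?_⟩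
    simp [hcomp, hij', hjl, hlk]

lemma avoids231_extend_iff : Avoids231 (extend π) ↔ ¬ Contains π p231 := by
  rw [contains_p231_iff]
  constructor
  · rintro h ⟨i, j, k, hij, hjk, hki, hij'⟩
    rw [Fin.lt_def, ← extend_val, ← extend_val] at hki hij'
    exact h hij hjk hki hij'
  · intro h i j k hij hjk hki hij'
    have hk := (isPermSeq_extend π).lt_of_inversion (hij.trans hjk) hki
    lift k to Fin n using hk
    lift j to Fin n using hjk.trans k.isLt
    lift i to Fin n using hij.trans j.isLt
    simp only [extend_val, Fin.val_fin_lt] at hij hjk hki hij'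
    exact h ⟨i, j, k, hij, hjk, hki, hij'⟩

lemma avoids1243_extend_iff : Avoids1243 (extend π) ↔ ¬ Contains π p1243 := by
  rw [contains_p1243_iff]
  constructor
  · rintro h ⟨i, j, k, l, hij, hjk, hkl, hij', hjl, hlk⟩
    rw [Fin.lt_def, ← extend_val, ← extend_val] at hij' hjl hlk
    exact h hij hjk hkl hij' hjl hlk
  · intro h i j k l hij hjk hkl hij' hjl hlk
    have hl := (isPermSeq_extend π).lt_of_inversion hkl hlk
    lift l to Fin n using hl
    lift k to Fin n using hkl.trans l.isLt
    lift j to Fin n using hjk.trans k.isLt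
    lift i to Fin n using hij.trans j.isLt
    simp only [extend_val, Fin.val_fin_lt] at hij hjk hkl hij' hjl hlk
    exact h ⟨i, j, k, l, hij, hjk, hkl, hij', hjl, hlk⟩

lemma mem_Av_iff_extend_mem :
    π ∈ Av n {⟨3, p231⟩, ⟨4, p1243⟩} ↔ extend π ∈ avoiders231And1243 := by
  simp [Av, avoiders231And1243, avoids231_extend_iff, avoids1243_extend_iff]

lemma exists_isDescent_iff {d : ℕ} :
    (∃ e : {d // IsDescent π d}, (e.1 : ℕ) = d) ↔ extend π (d + 1) < extend π d := by
  constructor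
  · rintro ⟨⟨e, he, hlt⟩, rfl⟩
    simpa only [← extend_val, Fin.lt_def] using hlt
  · intro hd
    have hlt := (isPermSeq_extend π).lt_of_inversion d.lt_succ_self hd
    refine ⟨⟨⟨d, d.lt_succ_self.trans hlt⟩, hlt, ?_⟩, rfl⟩
    simpa only [← extend_val, Fin.lt_def] using hd

end patterns

namespace Hook

variable {n : ℕ} {π : Equiv.Perm (Fin n)} {H K : Hook π}

/-- No point of the plot lies directly above the hook. -/
def IsClear (H : Hook π) : Prop := ∀ l, H.sw ≤ l → l ≤ H.ne → π l ≤ π H.ne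

lemma forall_not_above_iff_isClear :
    (∀ l : Fin n, ∀ q ∈ H.points, ¬ (q.1 = (plotPoint π l).1 ∧ q.2 < (plotPoint π l).2)) ↔
      H.IsClear := by
  constructor
  · intro h l hsw hne
    by_contra hlt
    refine h l ((plotPoint π l).1, (plotPoint π H.ne).2) (Or.inr ⟨rfl, ?_, ?_⟩) ⟨rfl, ?_⟩
    · simpa [plotPoint] using hsw
    · simpa [plotPoint] using hne
    · simpa [plotPoint] using hlt
  · rintro h l ⟨x, y⟩ (⟨hx, hy, -⟩ | ⟨hy, hsw, hne⟩) ⟨hxl, hyl⟩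
    · obtain rfl : H.sw = l := Fin.ext (Nat.cast_injective (hx.symm.trans hxl))
      exact absurd hyl (not_lt.2 hy)
    · obtain rfl : x = (l : ℕ) := hxl
      obtain rfl : y = (π H.ne : ℕ) := hy
      have hle := h l (Fin.le_def.2 (Nat.cast_le.1 hsw)) (Fin.le_def.2 (Nat.cast_le.1 hne))
      exact absurd hyl (not_lt.2 (Nat.cast_le.2 hle))

lemma ne_lt_ne_of_inter (hH : H.IsClear) (hK : K.IsClear) (hlt : H.sw < K.sw) (hsw : K.sw < H.ne)
    (hinter : ∀ q ∈ H.points ∩ K.points, (q = plotPoint π H.ne ∧ q = plotPoint π K.sw) ∨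
      (q = plotPoint π H.sw ∧ q = plotPoint π K.ne)) : K.ne < H.ne := by
  by_contra! hne
  have hmem : (((K.sw : ℕ) : ℝ), ((π H.ne : ℕ) : ℝ)) ∈ H.points ∩ K.points := by
    refine ⟨Or.inr ⟨rfl, ?_, ?_⟩, Or.inl ⟨rfl, ?_, ?_⟩⟩
    · simpa [plotPoint] using hlt.le
    · simpa [plotPoint] using hsw.le
    · simpa [plotPoint] using hH K.sw hlt.le hsw.le
    · simpa [plotPoint] using hK H.ne hsw.le hne
  rcases hinter _ hmem with ⟨h, -⟩ | ⟨h, -⟩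
  · exact hsw.ne (Fin.ext (Nat.cast_injective (congrArg Prod.fst h)))
  · exact hlt.ne' (Fin.ext (Nat.cast_injective (congrArg Prod.fst h)))

lemma eq_plotPoint_of_mem_inter (hH : H.IsClear) (hlt : H.sw < K.sw)
    (hne : K.sw < H.ne → K.ne < H.ne) {q : ℝ × ℝ} (hq : q ∈ H.points ∩ K.points) :
    q = plotPoint π H.ne ∧ q = plotPoint π K.sw := by
  have hsw : ((H.sw : ℕ) : ℝ) < (K.sw : ℕ) := by exact_mod_cast hlt
  obtain ⟨x, y⟩ := q
  obtain ⟨⟨hx, -⟩ | ⟨hy, -, hxne⟩, ⟨hxK, hyK, hyK'⟩ | ⟨hyK, hxK, -⟩⟩ := hq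
  · exact absurd (hx.symm.trans hxK) hsw.ne
  · exact absurd (hxK.trans hx.le) hsw.not_ge
  · obtain rfl : x = (K.sw : ℕ) := hxK
    obtain rfl : y = (π H.ne : ℕ) := hy
    have hle : K.sw ≤ H.ne := Fin.le_def.2 (Nat.cast_le.1 hxne)
    rcases hle.eq_or_lt with heq | hlt'
    · exact ⟨by rw [plotPoint, heq], by rw [plotPoint, heq]⟩
    · have hge : π H.ne ≤ π K.ne := Fin.le_def.2 (Nat.cast_le.1 hyK')
      have hle := hH K.ne (hlt.trans K.sw_lt_ne).le (hne hlt').le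
      exact absurd (π.injective (hle.antisymm hge)) (hne hlt').ne
  · have heq : K.ne = H.ne :=
      π.injective (Fin.ext (Nat.cast_injective (hyK.symm.trans hy)))
    exact absurd heq (hne (heq ▸ K.sw_lt_ne)).ne

end Hook

namespace VHC

variable {n : ℕ} {π : Equiv.Perm (Fin n)} (H : VHC π)

/-- The columns of the northeast endpoints of the hooks of a valid hook configuration, with value
`0` at the columns that are not descents, as in `HookedSeq`. -/
noncomputable def hookEnd : ℕ → ℕ :=
  Function.extend (fun d : {d // IsDescent π d} => (d.1 : ℕ)) (fun d => ((H.hook d).ne : ℕ)) 0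

lemma hookEnd_val (d : {d // IsDescent π d}) : H.hookEnd d.1 = (H.hook d).ne :=
  (Fin.val_injective.comp Subtype.val_injective).extend_apply _ _ d

lemma exists_eq_of_hookEnd_ne_zero {d : ℕ} (hd : H.hookEnd d ≠ 0) :
    ∃ e : {d // IsDescent π d}, (e.1 : ℕ) = d := by
  by_contra h
  exact hd (Function.extend_apply' _ _ d h)

lemma lt_hookEnd (d : {d // IsDescent π d}) : (d.1 : ℕ) < H.hookEnd d.1 := by
  have hlt := (H.hook d).sw_lt_ne
  rw [H.sw_hook] at hlt
  rwa [hookEnd_val]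

lemma isClear_hook (d : {d // IsDescent π d}) : (H.hook d).IsClear :=
  Hook.forall_not_above_iff_isClear.1 (H.not_above d)

lemma hookEnd_lt_hookEnd {d e : {d // IsDescent π d}} (hde : d.1 < e.1)
    (he : (e.1 : ℕ) < H.hookEnd d.1) : H.hookEnd e.1 < H.hookEnd d.1 := by
  rw [hookEnd_val] at he
  rw [hookEnd_val, hookEnd_val]
  exact Hook.ne_lt_ne_of_inter (H.isClear_hook d) (H.isClear_hook e) (by rwa [sw_hook, sw_hook])
    (by rwa [sw_hook]) (H.inter d e (by rintro rfl; exact lt_irrefl _ hde))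

lemma isPartialConfig : IsPartialConfig n ⟨extend π, H.hookEnd⟩ where
  isPermSeq := isPermSeq_extend π
  descent d hd := exists_isDescent_iff.1 (H.exists_eq_of_hookEnd_ne_zero hd)
  lt_hookEnd d hd := by
    obtain ⟨d, rfl⟩ := H.exists_eq_of_hookEnd_ne_zero hd
    exact H.lt_hookEnd d
  hookEnd_lt d hd := by
    obtain ⟨d, rfl⟩ := H.exists_eq_of_hookEnd_ne_zero hd
    exact (H.hookEnd_val d).trans_lt (H.hook d).ne.isLt
  entry_lt d l hdl hl := by
    obtain ⟨d, rfl⟩ := H.exists_eq_of_hookEnd_ne_zero (Nat.ne_zero_of_lt hl)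
    simp only [hookEnd_val] at hl ⊢
    lift l to Fin n using hl.trans (H.hook d).ne.isLt
    rw [extend_val, extend_val]
    exact (H.isClear_hook d l (by rwa [sw_hook]) (Fin.le_of_lt hl)).lt_of_ne
      fun h => hl.ne (congrArg _ (π.injective h))
  nested d e hde he hdesc := by
    obtain ⟨d, rfl⟩ := H.exists_eq_of_hookEnd_ne_zero (Nat.ne_zero_of_lt he)
    obtain ⟨e, rfl⟩ := exists_isDescent_iff.2 hdesc
    exact ⟨Nat.ne_zero_of_lt (H.lt_hookEnd e), H.hookEnd_lt_hookEnd hde he⟩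

lemma openDescents_eq_empty : (⟨extend π, H.hookEnd⟩ : HookedSeq).openDescents = ∅ := by
  refine Set.eq_empty_of_forall_notMem fun d ⟨hdesc, h0⟩ => ?_
  obtain ⟨d, rfl⟩ := exists_isDescent_iff.2 hdesc
  exact (Nat.ne_zero_of_lt (H.lt_hookEnd d)) h0

end VHC

variable {n : ℕ} {f : ℕ → ℕ} {π : Equiv.Perm (Fin n)}

lemma IsPartialConfig.exists_hook (hp : IsPartialConfig n ⟨extend π, f⟩) {d : Fin n}
    (hd : f d ≠ 0) : ∃ H : Hook π, H.sw = d ∧ (H.ne : ℕ) = f d ∧ H.IsClear := by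
  obtain ⟨m, hm⟩ : ∃ m : Fin n, (m : ℕ) = f d := ⟨⟨f d, hp.hookEnd_lt d hd⟩, rfl⟩
  have hdm : d < m := by
    rw [Fin.lt_def, hm]
    exact hp.lt_hookEnd d hd
  have hlt (l : Fin n) (hdl : d ≤ l) (hlm : l < m) : π l < π m := by
    have hlt := hp.entry_lt d l hdl ((Fin.lt_def.1 hlm).trans_eq hm)
    simpa only [← hm, extend_val, Fin.val_fin_lt] using hlt
  refine ⟨⟨d, m, hdm, hlt d le_rfl hdm⟩, rfl, hm, fun l hdl hlm => ?_⟩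
  rcases hlm.eq_or_lt with rfl | hlm
  exacts [le_rfl, (hlt l hdl hlm).le]

lemma IsPartialConfig.exists_vhc (hp : IsPartialConfig n ⟨extend π, f⟩)
    (hopen : (⟨extend π, f⟩ : HookedSeq).openDescents = ∅) :
    ∃ H : VHC π, ∀ d, ((H.hook d).ne : ℕ) = f d.1 := by
  have hdesc (d : {d // IsDescent π d}) : extend π ((d.1 : ℕ) + 1) < extend π d.1 :=
    exists_isDescent_iff.1 ⟨d, rfl⟩
  have hf (d : {d // IsDescent π d}) : f d.1 ≠ 0 := fun h => hopen.le ⟨hdesc d, h⟩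
  choose hook hsw hne hclear using fun d : {d // IsDescent π d} => hp.exists_hook (hf d)
  have hinter {d e : {d // IsDescent π d}} (hde : d.1 < e.1) {q : ℝ × ℝ}
      (hq : q ∈ (hook d).points ∩ (hook e).points) :
      q = plotPoint π (hook d).ne ∧ q = plotPoint π (hook e).sw := by
    refine Hook.eq_plotPoint_of_mem_inter (hclear d) (by rwa [hsw, hsw]) (fun hlt => ?_) hq
    rw [hsw, Fin.lt_def, hne] at hlt
    rw [Fin.lt_def, hne, hne]
    exact (hp.nested d.1 e.1 hde hlt (hdesc e)).2
  refine ⟨⟨hook, hsw, fun d => Hook.forall_not_above_iff_isClear.2 (hclear d), ?_⟩, hne⟩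
  intro d e hde q hq
  rcases lt_or_gt_of_ne (Subtype.val_injective.ne hde) with hlt | hgt
  · exact Or.inl (hinter hlt hq)
  · exact Or.inr (hinter hgt hq.symm).symm

/-- A valid hook configuration, together with its permutation, as a partial configuration. -/
noncomputable def toHookedSeq (x : Σ π : Equiv.Perm (Fin n), VHC π) : HookedSeq :=
  ⟨extend x.1, x.2.hookEnd⟩

lemma toHookedSeq_injective (n : ℕ) : Function.Injective (toHookedSeq (n := n)) := by
  rintro ⟨π, H⟩ ⟨ρ, K⟩ h
  obtain rfl : π = ρ := extend_injective n (congrArg HookedSeq.entry h)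
  have hends : H.hookEnd = K.hookEnd := congrArg HookedSeq.hookEnd h
  refine congrArg (Sigma.mk π) (VHC.ext (funext fun d => Hook.ext ?_ (Fin.ext ?_)))
  · rw [H.sw_hook, K.sw_hook]
  · rw [← H.hookEnd_val, ← K.hookEnd_val, hends]

lemma exists_toHookedSeq_eq {p : HookedSeq} (hp : IsPartialConfig n p)
    (hopen : p.openDescents = ∅) : ∃ x, toHookedSeq (n := n) x = p := by
  obtain ⟨σ, f⟩ := p
  obtain ⟨π, rfl⟩ := hp.isPermSeq.exists_extend_eq
  obtain ⟨H, hH⟩ := hp.exists_vhc hopen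
  refine ⟨⟨π, H⟩, HookedSeq.ext rfl (funext fun d => ?_)⟩
  change H.hookEnd d = f d
  by_cases hd : ∃ e : {d // IsDescent π d}, (e.1 : ℕ) = d
  · obtain ⟨d, rfl⟩ := hd
    rw [H.hookEnd_val, hH]
  · have hfd : f d = 0 := not_not.1 (mt (hp.descent d) (mt exists_isDescent_iff.2 hd))
    rw [not_not.1 (mt H.exists_eq_of_hookEnd_ne_zero hd), hfd]

lemma image_toHookedSeq_VHCs (n : ℕ) :
    toHookedSeq '' VHCs (Av n {⟨3, p231⟩, ⟨4, p1243⟩}) = configs avoiders231And1243 n 0 := by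
  ext p
  constructor
  · rintro ⟨⟨π, H⟩, hπ, rfl⟩
    exact ⟨H.isPartialConfig, mem_Av_iff_extend_mem.1 hπ,
      H.openDescents_eq_empty ▸ Set.ncard_empty ℕ⟩
  · rintro ⟨hp, hA, hs⟩
    obtain ⟨x, rfl⟩ :=
      exists_toHookedSeq_eq hp ((Set.ncard_eq_zero hp.finite_openDescents).1 hs)
    exact ⟨x, mem_Av_iff_extend_mem.2 hA, rfl⟩

lemma ncard_VHCs (n : ℕ) : (VHCs (Av n {⟨3, p231⟩, ⟨4, p1243⟩})).ncard =
    (configs avoiders231And1243 n 0).ncard := by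
  rw [← image_toHookedSeq_VHCs, Set.ncard_image_of_injective _ (toHookedSeq_injective n)]

lemma vhcSeries_eq : (PowerSeries.mk fun n =>
    ((VHCs (Av n {⟨3, p231⟩, ⟨4, p1243⟩})).ncard : ℚ)) =
      1 + PowerSeries.X * configSeries avoiders231And1243 0 := by
  ext (_ | n)
  · simp [ncard_VHCs, ncard_configs_of_le_one id_mem_avoiders231And1243]
  · simp [ncard_VHCs, configSeries, PowerSeries.coeff_succ_X_mul, PowerSeries.coeff_one]

end HookConfig

theorem mainTheorem6 :
    ∃ S : PowerSeries ℚ,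
      -- `S` is the formal power series `√(1 - 2x - 3x²)`
      (PowerSeries.constantCoeff S = 1 ∧ S ^ 2 = 1 - 2 * PowerSeries.X - 3 * PowerSeries.X ^ 2) ∧
      -- the quotient is taken in the field of formal Laurent series
      (3 * PowerSeries.X - 1 + S : PowerSeries ℚ) ≠ 0 ∧
      ((PowerSeries.mk fun n : ℕ =>
          ((HookConfig.VHCs (HookConfig.Av n
            {⟨3, HookConfig.p231⟩, ⟨4, HookConfig.p1243⟩})).ncard : ℚ) : PowerSeries ℚ) :
          LaurentSeries ℚ) =
        1 + ((2 * PowerSeries.X ^ 2 : PowerSeries ℚ) : LaurentSeries ℚ) /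
          ((3 * PowerSeries.X - 1 + S : PowerSeries ℚ) : LaurentSeries ℚ) := by
  obtain ⟨S, hS0, hS⟩ := HookConfig.exists_sq_eq_one_sub_two_mul_X_sub
  obtain ⟨t, ht, hSt⟩ := HookConfig.exists_eq_one_sub_X_sub_two_mul_X_mul hS0 hS
  have hcount := HookConfig.one_sub_mul_configSeries_zero ht
  have hden : 3 * PowerSeries.X - 1 + S = 2 * PowerSeries.X * (1 - t) := by
    rw [hSt]
    ring
  have hne : 3 * PowerSeries.X - 1 + S ≠ 0 := by
    have : CharZero (PowerSeries ℚ) := algebraRat.charZero _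
    rw [hden]
    exact mul_ne_zero (mul_ne_zero (OfNat.ofNat_ne_zero 2) PowerSeries.X_ne_zero)
      (left_ne_zero_of_mul_eq_one hcount)
  have hne' : ((3 * PowerSeries.X - 1 + S : PowerSeries ℚ) : LaurentSeries ℚ) ≠ 0 :=
    (map_ne_zero_iff _ HahnSeries.ofPowerSeries_injective).2 hne
  refine ⟨S, ⟨hS0, hS⟩, hne, ?_⟩
  rw [HookConfig.vhcSeries_eq, PowerSeries.coe_add, PowerSeries.coe_one, add_right_inj,
    eq_div_iff hne', ← PowerSeries.coe_mul, hden]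
  refine congrArg _ ?_
  linear_combination 2 * PowerSeries.X ^ 2 * hcount
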